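/- Let $\mathbb K$ be a field, $R=\mathbb K[x_1,\dots,x_n]$ and $\mathbf a\in\mathbb N^n$. **Diagrams.** Let $\lambda-\mu=(\lambda_1,\dots,\lambda_h;\mu_1,\dots,\mu_h)$ be integers with $i-1\le\mu_i<\lambda_i\le n$ for $i\in[h]$, let $D=\{(i,j): i\in[h],\ \mu_i<j\le\lambda_i\}$ (row $i$, column $j$; rows are numbered southward, columns eastward), and let $I=I_{\lambda-\mu}=(x_ix_j\mid (i,j)\in D)$. A move $c\to c'$ between points of $D$ is a quasi-Borel move if $c,c'$ lie in the same row or in the same column; it is minimal if no other point of $D$ lies on the segment from $c$ to $c'$. $D$ is connected if any two of its points are joined by a walk in $D$ of quasi-Borel moves of length $1$. **Order.** For connected $D$, order the points linearly by removing them successively, later points first, as follows. If $h=1$, remove the rightmost point. If $h\ge2$, let $t$ be the least column that meets both row $h-1$ and row $h$, and remove a point of row $h$: its only point $(h,t)$ if the row is a single point; otherwise its rightmost point if $\lambda_h>t$, and its leftmost point if $\lambda_h=t$. A minimal quasi-Borel move $c\to c'$ is good if $c'$ precedes $c$. For $c=(i,j)\in D$ put $f_c=x_ix_j$, and let $X_c$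 be the set of variables $x_q$ for which there is $p\ne q$ such that $f_cx_p/x_q=f_{c'}$ for some $c'\in D$ preceding $c$. $D$ is compatible if it is connected, all horizontal good moves point westward, and for every $c\in D$ exactly two good moves start from $c$ if and only if $|X_c|=2$. **Dual.** For a monomial ideal $J$ with minimal monomial generators $G(J)$, $J$ is $\mathbf a$-determined if every $f\in G(J)$ divides $\mathbf x^{\mathbf a}$; then $\widehat J^{[\mathbf a]}=(\mathbf x^{\mathbf a}/f\mid f\in G(J))$. **Cell complex.** Let $D$ be compatible and $I$ be $\mathbf a$-determined. The $0$-cells of $X_I$ are the points of $D$; the $1$-cells are the good moves, oriented as moves (westward or northward); the $2$-cells are the bounded rectangular components cut in the plane by the good moves, oriented so that the induced boundary orientation is counterclockwise. The vertex $c$ is labeled by $\mathbf x^{\mathbf a}/f_c$, and each other cell by the least common multiple of the labels of its vertices. Let $$\mathcal F_{X_I}:\quad 0\to R^{F_2(X_I)}\xrightarrow{\partial_2}R^{F_1(X_I)}\xrightarrow{\partial_1}R^{F_0(X_I)}\xrightarrow{\partial_0}R\to 0$$ be the cellular free complex of this labeled oriented complex: $F_k(X_I)$ is the set of $k$-cells,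 the basis element of a cell $P$ with label $\mathbf x^{\alpha_P}$ has multidegree $\alpha_P$, $\partial(P)=\sum_Q\varepsilon(Q,P)\,\mathbf x^{\alpha_P-\alpha_Q}Q$ over the facets $Q$ of $P$ with the signs $\varepsilon(Q,P)=\pm1$ given by the orientations, and $\partial_0(c)=\mathbf x^{\mathbf a}/f_c$. **Theorem.** If $I=I_{\lambda-\mu}$ is $\mathbf a$-determined and $D$ is compatible, then $\mathcal F_{X_I}$ is a multigraded free resolution of $R/\widehat I^{[\mathbf a]}$. If moreover $\widehat I^{[\mathbf a]}\ne R$, this resolution is minimal. -/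

import Mathlib

/-- Raw data `(λ_1, …, λ_h; μ_1, …, μ_h)`; only the values at `1, …, h` are meaningful. -/
structure RowData where
  h : ℕ
  lam : ℕ → ℕ
  mu : ℕ → ℕ

namespace RowData

/-- `i - 1 ≤ μ_i < λ_i` for all `i ∈ [h]`. -/
def IsShiftedPartition (P : RowData) : Prop :=
  ∀ i ∈ Finset.Icc 1 P.h, i - 1 ≤ P.mu i ∧ P.mu i < P.lam i

/-- The diagram `D_{λ-μ}`; a lattice point `(i, j)` lies in row `i` (rows are numbered southward)
and column `j` (columns are numbered eastward). -/
def diagram (P : RowData) : Finset (ℕ × ℕ) :=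
  (Finset.Icc 1 P.h).biUnion fun i => (Finset.Ioc (P.mu i) (P.lam i)).image fun j => (i, j)

theorem mem_diagram {P : RowData} {c : ℕ × ℕ} :
    c ∈ P.diagram ↔ (1 ≤ c.1 ∧ c.1 ≤ P.h) ∧ P.mu c.1 < c.2 ∧ c.2 ≤ P.lam c.1 := by
  obtain ⟨i, j⟩ := c
  simp only [diagram, Finset.mem_biUnion, Finset.mem_image, Finset.mem_Icc, Finset.mem_Ioc,
    Prod.mk.injEq]
  constructor
  · rintro ⟨i', hi, j', hj, rfl, rfl⟩
    exact ⟨hi, hj⟩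
  · rintro ⟨hi, hj⟩
    exact ⟨i, hi, j, hj, rfl, rfl⟩

end RowData

/-- A quasi-Borel move. -/
def IsQuasiBorelMove (c c' : ℕ × ℕ) : Prop := c.1 = c'.1 ∨ c.2 = c'.2

/-- The geometric length of a quasi-Borel move. -/
def geomLength (c c' : ℕ × ℕ) : ℕ := max (Nat.dist c.1 c'.1) (Nat.dist c.2 c'.2)

/-- A quasi-Borel move between points of `D` with no other point of `D` on the segment between
them (for a quasi-Borel move, that segment is the order interval `Set.uIcc c c'`). -/
def IsMinimalMove (D : Finset (ℕ × ℕ)) (c c' : ℕ × ℕ) : Prop :=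
  c ∈ D ∧ c' ∈ D ∧ IsQuasiBorelMove c c' ∧ ∀ p ∈ D, p ∈ Set.uIcc c c' → p = c ∨ p = c'

/-- Any two points of `D` are joined by a walk in `D` of quasi-Borel moves of length one. -/
def IsConnectedDiagram (D : Finset (ℕ × ℕ)) : Prop :=
  ∀ c ∈ D, ∀ c' ∈ D, Relation.ReflTransGen
    (fun p q => p ∈ D ∧ q ∈ D ∧ IsQuasiBorelMove p q ∧ geomLength p q = 1) c c'

namespace RowData

/-- The least column met by both of the last two rows (used for `2 ≤ h`). -/
noncomputable def overlap (P : RowData) : ℕ :=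
  sInf {j | (P.mu (P.h - 1) < j ∧ j ≤ P.lam (P.h - 1)) ∧ (P.mu P.h < j ∧ j ≤ P.lam P.h)}

/-- The point removed first: the rightmost one if there is one row only; otherwise, in the last
row, the only point, the rightmost one or the leftmost one, as the case may be. -/
noncomputable def lastPoint (P : RowData) : ℕ × ℕ :=
  if P.h ≤ 1 then (1, P.lam 1)
  else if P.mu P.h + 1 = P.overlap ∧ P.lam P.h = P.overlap then (P.h, P.overlap)
  else if P.overlap < P.lam P.h then (P.h, P.lam P.h)
  else (P.h, P.mu P.h + 1)

/-- The row data after removal of `lastPoint`. -/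
noncomputable def removeLast (P : RowData) : RowData :=
  if P.h ≤ 1 then { P with lam := Function.update P.lam 1 (P.lam 1 - 1) }
  else if P.mu P.h + 1 = P.overlap ∧ P.lam P.h = P.overlap then { P with h := P.h - 1 }
  else if P.overlap < P.lam P.h then
    { P with lam := Function.update P.lam P.h (P.lam P.h - 1) }
  else { P with mu := Function.update P.mu P.h (P.mu P.h + 1) }

/-- The linear order on the points of the diagram (that is, on the generators): `c` precedes `c'`
if `c'` is removed before `c` when the points are removed successively. -/
def Precedes (P : RowData) (c c' : ℕ × ℕ) : Prop :=
  ∃ k l, k < l ∧ l < P.diagram.card ∧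
    c' = (removeLast^[k] P).lastPoint ∧ c = (removeLast^[l] P).lastPoint

/-- A good move: a minimal quasi-Borel move to an earlier point. -/
def IsGoodMove (P : RowData) (c c' : ℕ × ℕ) : Prop :=
  IsMinimalMove P.diagram c c' ∧ P.Precedes c' c

end RowData

/-- The exponent vector of `x_i x_j` for `c = (i, j)`. The index `k : Fin n` stands for the
variable `x_{k+1}`. -/
noncomputable def pointExp (n : ℕ) (c : ℕ × ℕ) : Fin n →₀ ℕ :=
  Finsupp.equivFunOnFinite.symm fun k =>
    (if (k : ℕ) + 1 = c.1 then 1 else 0) + (if (k : ℕ) + 1 = c.2 then 1 else 0)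

namespace RowData

/-- The variables `x_j` such that, for some `i ≠ j`, `f_c x_i / x_j` is a generator
that precedes `f_c`. -/
def exchangeSet (P : RowData) (n : ℕ) (c : ℕ × ℕ) : Set (Fin n) :=
  {j | ∃ i, i ≠ j ∧ ∃ c' ∈ P.diagram,
    pointExp n c' + Finsupp.single j 1 = pointExp n c + Finsupp.single i 1 ∧ P.Precedes c' c}

/-- All horizontal good moves point westward, and a point is the start of two good moves exactly
when its exchange set has two elements. -/
def IsCompatible (P : RowData) (n : ℕ) : Prop :=
  IsConnectedDiagram P.diagram ∧
  (∀ c c', P.IsGoodMove c c' → c.1 = c'.1 → c'.2 < c.2) ∧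
  ∀ c ∈ P.diagram, {c' | P.IsGoodMove c c'}.ncard = 2 ↔ (P.exchangeSet n c).ncard = 2

/-- The ideal `I_{λ-μ}`. -/
noncomputable def ideal (P : RowData) (K : Type*) [Field K] (n : ℕ) :
    Ideal (MvPolynomial (Fin n) K) :=
  Ideal.span ((fun c => MvPolynomial.monomial (pointExp n c) (1 : K)) '' P.diagram)

end RowData

/-! ### Duals of monomial ideals -/

section Dual

variable {K : Type*} [Field K] {n : ℕ}

/-- The exponents of the minimal monomial generators of a monomial ideal. -/
def minGenExps (I : Ideal (MvPolynomial (Fin n) K)) : Set (Fin n →₀ ℕ) :=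
  {e | Minimal (fun e => MvPolynomial.monomial e (1 : K) ∈ I) e}

/-- `I` is `a`-determined. -/
def IsDetermined (a : Fin n →₀ ℕ) (I : Ideal (MvPolynomial (Fin n) K)) : Prop :=
  ∀ e ∈ minGenExps I, e ≤ a

/-- The generalized Newton complementary dual of `I` determined by `a`. -/
noncomputable def dualIdeal (a : Fin n →₀ ℕ) (I : Ideal (MvPolynomial (Fin n) K)) :
    Ideal (MvPolynomial (Fin n) K) :=
  Ideal.span ((fun e => MvPolynomial.monomial (a - e) (1 : K)) '' minGenExps I)

end Dual

/-! ### The planar cell complex -/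

/-- The rectangle with rows from `top` to `bot` and columns from `left` to `right`. -/
structure LatticeRect where
  top : ℕ
  bot : ℕ
  left : ℕ
  right : ℕ

namespace RowData

/-- The unit segment from `(i, j)` to `(i, j + 1)` lies on a good move. -/
def HSegment (P : RowData) (i j : ℕ) : Prop :=
  ∃ c c', P.IsGoodMove c c' ∧ c.1 = i ∧ c'.1 = i ∧ min c.2 c'.2 ≤ j ∧ j + 1 ≤ max c.2 c'.2

/-- The unit segment from `(i, j)` to `(i + 1, j)` lies on a good move. -/
def VSegment (P : RowData) (i j : ℕ) : Prop :=
  ∃ c c', P.IsGoodMove c c' ∧ c.2 = j ∧ c'.2 = j ∧ min c.1 c'.1 ≤ i ∧ i + 1 ≤ max c.1 c'.1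

/-- The interior of the rectangle is a bounded component of the complement of the good moves in
the plane: the four sides are covered by good moves, and no good move meets the interior. -/
def IsTwoCell (P : RowData) (Z : LatticeRect) : Prop :=
  Z.top < Z.bot ∧ Z.left < Z.right ∧
  (∀ j, Z.left ≤ j → j < Z.right →
    P.HSegment Z.top j ∧ P.HSegment Z.bot j ∧
      ∀ i, Z.top < i → i < Z.bot → ¬ P.HSegment i j) ∧
  (∀ i, Z.top ≤ i → i < Z.bot →
    P.VSegment i Z.left ∧ P.VSegment i Z.right ∧
      ∀ j, Z.left < j → j < Z.right → ¬ P.VSegment i j)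

open Classical in
/-- The good moves. -/
noncomputable def edges (P : RowData) : Finset ((ℕ × ℕ) × (ℕ × ℕ)) :=
  (P.diagram ×ˢ P.diagram).filter fun e => P.IsGoodMove e.1 e.2

/-- The `0`-cells. -/
abbrev Cell0 (P : RowData) : Type := {c // c ∈ P.diagram}

/-- The `1`-cells: an edge `(c, c')` is the good move from `c` to `c'`, oriented in this way. -/
abbrev Cell1 (P : RowData) : Type := {e // e ∈ P.edges}

/-- The `2`-cells. -/
abbrev Cell2 (P : RowData) : Type := {Z // P.IsTwoCell Z}

section Labels

variable (P : RowData) {n : ℕ} (a : Fin n →₀ ℕ)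

/-- The vertex `(i, j)` is labeled by `x^a / (x_i x_j)`. -/
noncomputable def label0 (c : P.Cell0) : Fin n →₀ ℕ := a - pointExp n c.1

/-- The label of an edge is the lcm of the labels of its end points. -/
noncomputable def label1 (e : P.Cell1) : Fin n →₀ ℕ :=
  (a - pointExp n e.1.1) ⊔ (a - pointExp n e.1.2)

/-- The label of a rectangle is the lcm of the labels of the vertices that it contains. -/
noncomputable def label2 (Z : P.Cell2) : Fin n →₀ ℕ :=
  (P.diagram.filter fun c =>
    (Z.1.top ≤ c.1 ∧ c.1 ≤ Z.1.bot) ∧ Z.1.left ≤ c.2 ∧ c.2 ≤ Z.1.right).sup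
      fun c => a - pointExp n c

end Labels

/-- Incidence of a vertex and an edge: the end point minus the starting point. -/
def incidence1 (P : RowData) (c : P.Cell0) (e : P.Cell1) : ℤ :=
  if c.1 = e.1.2 then 1 else if c.1 = e.1.1 then -1 else 0

/-- Incidence of an edge and a rectangle. The boundary of the rectangle is oriented
counterclockwise, horizontal edges point westward, vertical ones northward: edges on the top and
right sides have sign `1`, edges on the bottom and left sides have sign `-1`. -/
def incidence2 (P : RowData) (e : P.Cell1) (Z : P.Cell2) : ℤ :=
  if e.1.1.1 = e.1.2.1 ∧ Z.1.left ≤ e.1.2.2 ∧ e.1.1.2 ≤ Z.1.right then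
    (if e.1.1.1 = Z.1.top then 1 else if e.1.1.1 = Z.1.bot then -1 else 0)
  else if e.1.1.2 = e.1.2.2 ∧ Z.1.top ≤ e.1.2.1 ∧ e.1.1.1 ≤ Z.1.bot then
    (if e.1.1.2 = Z.1.right then 1 else if e.1.1.2 = Z.1.left then -1 else 0)
  else 0

end RowData

/-! ### Cellular complexes and free resolutions -/

section Cellular

open MvPolynomial

variable (K : Type*) [Field K] {n : ℕ}

/-- The differential of a cellular free complex:
`∂ p = ∑ q, ε (q, p) x ^ (α p - β q) q`, where `α` and `β` are the labels. -/
noncomputable def cellularDiff {ι κ : Type*} [Fintype κ] (α : ι → Fin n →₀ ℕ)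
    (β : κ → Fin n →₀ ℕ) (ε : κ → ι → ℤ) :
    (ι →₀ MvPolynomial (Fin n) K) →ₗ[MvPolynomial (Fin n) K] (κ →₀ MvPolynomial (Fin n) K) :=
  Finsupp.linearCombination (MvPolynomial (Fin n) K) fun p =>
    ∑ q, Finsupp.single q (monomial (α p - β q) ((ε q p : ℤ) : K))

namespace RowData

variable (P : RowData) (a : Fin n →₀ ℕ)

/-- `∂₀`, onto the free module of the empty face (with label `1`). -/
noncomputable def d0 :
    (P.Cell0 →₀ MvPolynomial (Fin n) K) →ₗ[MvPolynomial (Fin n) K] MvPolynomial (Fin n) K :=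
  Finsupp.linearCombination (MvPolynomial (Fin n) K) fun c => monomial (P.label0 a c) (1 : K)

/-- `∂₁`. -/
noncomputable def d1 :
    (P.Cell1 →₀ MvPolynomial (Fin n) K) →ₗ[MvPolynomial (Fin n) K]
      (P.Cell0 →₀ MvPolynomial (Fin n) K) :=
  cellularDiff K (P.label1 a) (P.label0 a) P.incidence1

/-- `∂₂`. -/
noncomputable def d2 :
    (P.Cell2 →₀ MvPolynomial (Fin n) K) →ₗ[MvPolynomial (Fin n) K]
      (P.Cell1 →₀ MvPolynomial (Fin n) K) :=
  cellularDiff K (P.label2 a) (P.label1 a) P.incidence2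

end RowData

variable {K}

/-- A linear map of free modules is multihomogeneous of degree `0`, when the basis elements have
the multidegrees `α p` and `β q`. -/
def IsMultihomogeneous {ι κ : Type*} (α : ι → Fin n →₀ ℕ) (β : κ → Fin n →₀ ℕ)
    (f : (ι →₀ MvPolynomial (Fin n) K) →ₗ[MvPolynomial (Fin n) K]
      (κ →₀ MvPolynomial (Fin n) K)) : Prop :=
  ∀ p q, ∃ t : K,
    monomial (β q) (1 : K) * f (Finsupp.single p 1) q = monomial (α p) t

/-- The image of `f` lies in `(x_1, …, x_n) • N`. -/
def IsMinimalMap {M N : Type*} [AddCommGroup M] [AddCommGroup N]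
    [Module (MvPolynomial (Fin n) K) M] [Module (MvPolynomial (Fin n) K) N]
    (f : M →ₗ[MvPolynomial (Fin n) K] N) : Prop :=
  LinearMap.range f ≤
    (Ideal.span (Set.range (X : Fin n → MvPolynomial (Fin n) K))) •
      (⊤ : Submodule (MvPolynomial (Fin n) K) N)

/-- `0 → F₂ → F₁ → F₀ → R → R/J → 0` is exact. -/
structure IsResolutionOfQuotient {F₂ F₁ F₀ : Type*} [AddCommGroup F₂] [AddCommGroup F₁]
    [AddCommGroup F₀] [Module (MvPolynomial (Fin n) K) F₂] [Module (MvPolynomial (Fin n) K) F₁]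
    [Module (MvPolynomial (Fin n) K) F₀]
    (d₂ : F₂ →ₗ[MvPolynomial (Fin n) K] F₁) (d₁ : F₁ →ₗ[MvPolynomial (Fin n) K] F₀)
    (d₀ : F₀ →ₗ[MvPolynomial (Fin n) K] MvPolynomial (Fin n) K)
    (J : Ideal (MvPolynomial (Fin n) K)) : Prop where
  injective : Function.Injective d₂
  exact₁ : Function.Exact d₂ d₁
  exact₀ : Function.Exact d₁ d₀
  exact_aug : Function.Exact d₀ (Submodule.mkQ J)

/-- The complex `F_{X_I}` is a multigraded free resolution of `R/J`. -/
structure RowData.SupportsResolution (P : RowData) (a : Fin n →₀ ℕ)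
    (J : Ideal (MvPolynomial (Fin n) K)) : Prop where
  resolution : IsResolutionOfQuotient (P.d2 K a) (P.d1 K a) (P.d0 K a) J
  homogeneous₂ : IsMultihomogeneous (P.label2 a) (P.label1 a) (P.d2 K a)
  homogeneous₁ : IsMultihomogeneous (P.label1 a) (P.label0 a) (P.d1 K a)
  homogeneous₀ : ∀ c, ∃ t : K, P.d0 K a (Finsupp.single c 1) = monomial (P.label0 a c) t

/-- The complex `F_{X_I}` is a minimal multigraded free resolution of `R/J`. -/
structure RowData.SupportsMinimalResolution (P : RowData) (a : Fin n →₀ ℕ)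
    (J : Ideal (MvPolynomial (Fin n) K)) : Prop extends P.SupportsResolution a J where
  minimal₂ : IsMinimalMap (P.d2 K a)
  minimal₁ : IsMinimalMap (P.d1 K a)
  minimal₀ : IsMinimalMap (P.d0 K a)

end Cellular

/-! Connectedness and westward horizontal good moves force the western ends `mu` of the rows to
increase weakly southward, and then the order of the points is lexicographic (`isLexOrdered`). So
the good moves from a point `(i, j)` are the unit step west and the step to the nearest point north,
as far as these exist, and the rectangles correspond to the points where both start
(`isTwoCell_iff`). The labels are `x^a / (x_i x_j)` on points, `x^a / x_i` on horizontal edges in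
row `i`, `x^a / x_j` on vertical edges in column `j`, and `x^a` on rectangles.

Exactness follows by eliminating leading terms for the lexicographic order. At `F₀` this is the
property of linear quotients (`exists_isGoodMove_inf_le`): the colon ideal of the earlier labels by
the label of `c` is generated by the variables of the good moves from `c`. The condition on exchange
sets is needed there only. At `F₁`, a leading point with one outgoing edge cannot occur in a cycle,
and one with two gives a relation `x_j u + x_i v = 0` with `i ≠ j`, a multiple of the Koszul
relation that the rectangle at this point realizes (`ker_d1_le`). At `F₂`, a rectangle of the
support whose bottom lies furthest south shares its bottom side with no other rectangle of the
support (`d2_injective`).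

The resolution is minimal because labels grow strictly from facets to cells, and no vertex label is
`1` if the dual is a proper ideal. -/

theorem Relation.ReflTransGen.exists_crossing {α : Type*} {R : α → α → Prop} (S : α → Prop)
    {a b : α} (h : Relation.ReflTransGen R a b) (ha : S a) (hb : ¬ S b) :
    ∃ x y, R x y ∧ S x ∧ ¬ S y := by
  induction h with
  | refl => exact absurd ha hb
  | @tail y z _ hyz ih =>
    by_cases hy : S y
    · exact ⟨y, z, hyz, hy, hb⟩
    · exact ih hy

/-! ### The order of removal is the reverse lexicographic one. -/

namespace RowData

variable {P Q : RowData} {n r s k : ℕ}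

theorem mk_mem_diagram {i j : ℕ} :
    (i, j) ∈ P.diagram ↔ (1 ≤ i ∧ i ≤ P.h) ∧ P.mu i < j ∧ j ≤ P.lam i := mem_diagram

theorem IsShiftedPartition.row (hP : P.IsShiftedPartition) (h1 : 1 ≤ r) (h2 : r ≤ P.h) :
    r ≤ P.mu r + 1 ∧ P.mu r < P.lam r := by
  have := hP r (Finset.mem_Icc.2 ⟨h1, h2⟩)
  omega

/-- Consecutive rows of a connected diagram meet a common column. -/
theorem rows_overlap (hP : P.IsShiftedPartition) (hc : IsConnectedDiagram P.diagram)
    (h1 : 1 ≤ r) (h2 : r + 1 ≤ P.h) :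
    P.mu r < P.lam (r + 1) ∧ P.mu (r + 1) < P.lam r := by
  have e1 := hP.row h1 (by omega)
  have e2 := hP.row (r := r + 1) (by omega) h2
  have hw := hc (r, P.lam r) (mk_mem_diagram.2 (by omega)) (r + 1, P.lam (r + 1))
    (mk_mem_diagram.2 (by omega))
  -- A walk from row `r` to row `r + 1` leaves the rows up to `r` by a vertical unit step, whose
  -- column meets both rows.
  obtain ⟨x, y, ⟨hx, hy, hq, hl⟩, hS, hS'⟩ :=
    hw.exists_crossing (fun c => c.1 ≤ r) (le_refl r) (by simp)
  obtain ⟨x1, x2⟩ := x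
  obtain ⟨y1, y2⟩ := y
  rw [mk_mem_diagram] at hx hy
  simp only [IsQuasiBorelMove, geomLength, Nat.dist] at hq hl hS hS'
  obtain rfl : x1 = r := by omega
  obtain rfl : y1 = x1 + 1 := by omega
  omega

theorem overlap_eq (h1 : Q.mu (Q.h - 1) < Q.lam (Q.h - 1)) (h2 : Q.mu (Q.h - 1) < Q.lam Q.h)
    (h3 : Q.mu Q.h < Q.lam (Q.h - 1)) (h4 : Q.mu Q.h < Q.lam Q.h) :
    Q.overlap = max (Q.mu (Q.h - 1)) (Q.mu Q.h) + 1 := by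
  have hm : max (Q.mu (Q.h - 1)) (Q.mu Q.h) + 1 ∈
      {j | (Q.mu (Q.h - 1) < j ∧ j ≤ Q.lam (Q.h - 1)) ∧ (Q.mu Q.h < j ∧ j ≤ Q.lam Q.h)} := by
    simp only [Set.mem_ofPred_eq]; omega
  refine le_antisymm (Nat.sInf_le hm) (le_csInf ⟨_, hm⟩ ?_)
  intro b hb
  simp only [Set.mem_ofPred_eq] at hb
  omega

/-- `Q` consists of the rows of `P` above row `r`, and of row `r` up to column `s`. -/
structure IsStage (P Q : RowData) (r s : ℕ) : Prop where
  h_eq : Q.h = r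
  lam_eq : ∀ i < r, Q.lam i = P.lam i
  lam_last : Q.lam r = s
  mu_eq : ∀ i ≤ r, Q.mu i = P.mu i

/-- The points of the diagram up to `(r, s)` in the lexicographic order. -/
def upTo (P : RowData) (r s : ℕ) : Finset (ℕ × ℕ) :=
  P.diagram.filter fun p => p.1 < r ∨ p.1 = r ∧ p.2 ≤ s

/-- After `k` removals, the points up to `(r, s)` in the lexicographic order are left. -/
structure Reaches (P : RowData) (k r s : ℕ) : Prop where
  stage : IsStage P (removeLast^[k] P) r s
  count : k + (P.upTo r s).card = P.diagram.card

theorem card_upTo_west (h : (r, s + 1) ∈ P.diagram) :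
    (P.upTo r (s + 1)).card = (P.upTo r s).card + 1 := by
  have : P.upTo r (s + 1) = insert (r, s + 1) (P.upTo r s) := by
    ext ⟨i, j⟩
    simp only [upTo, Finset.mem_filter, Finset.mem_insert, Prod.mk.injEq]
    constructor
    · rintro ⟨hD, hij⟩
      by_cases hij' : i = r ∧ j = s + 1
      · exact Or.inl hij'
      · exact Or.inr ⟨hD, by omega⟩
    · rintro (⟨rfl, rfl⟩ | ⟨hD, hij⟩)
      · exact ⟨h, by omega⟩
      · exact ⟨hD, by omega⟩
  rw [this, Finset.card_insert_of_notMem]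
  simp [upTo]

theorem upTo_row_start (hs : s ≤ P.mu (r + 1)) : P.upTo (r + 1) s = P.upTo r (P.lam r) := by
  ext ⟨i, j⟩
  simp only [upTo, Finset.mem_filter, and_congr_right_iff]
  intro hD
  rw [mk_mem_diagram] at hD
  constructor
  · rintro (hi | ⟨rfl, hj⟩)
    · rcases Nat.lt_succ_iff_lt_or_eq.1 hi with hi | rfl <;> omega
    · omega
  · omega

theorem Reaches.init (P : RowData) : P.Reaches 0 P.h (P.lam P.h) where
  stage := ⟨rfl, fun _ _ => rfl, rfl, fun _ _ => rfl⟩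
  count := by
    rw [upTo, Finset.filter_true_of_mem, zero_add]
    rintro ⟨i, j⟩ hD
    rw [mk_mem_diagram] at hD
    rcases hD.1.2.lt_or_eq with hi | rfl
    · exact Or.inl hi
    · exact Or.inr ⟨rfl, hD.2.2⟩

/-- For `2 ≤ r` the bounds on `s` place the overlap column at `s` or further west, so column `s + 1`
lies strictly east of it and the rightmost point goes. -/
theorem IsStage.step_west (h : IsStage P Q r (s + 1)) (hr : r = 1 ∧ P.mu r < s ∨
    2 ≤ r ∧ P.mu (r - 1) < P.lam (r - 1) ∧ P.mu r < P.lam (r - 1) ∧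
      P.mu (r - 1) < s ∧ P.mu r < s) :
    Q.lastPoint = (r, s + 1) ∧ IsStage P Q.removeLast r s := by
  obtain ⟨rfl, h2, h3, h4⟩ := h
  rcases hr with ⟨hr, hs⟩ | ⟨hr, hs⟩
  · rw [lastPoint, removeLast, if_pos hr.le, if_pos hr.le, ← h3, ← hr]
    refine ⟨rfl, rfl, fun i hi => ?_, ?_, fun i hi => h4 i hi⟩
    · simp only [Function.update_of_ne hi.ne]; exact h2 i hi
    · simp only [hr, Function.update_self]; rw [hr] at h3; omega
  · have e1 := h2 (Q.h - 1) (by omega)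
    have e2 := h4 (Q.h - 1) (by omega)
    have e3 := h4 Q.h le_rfl
    have ho : Q.overlap = _ := overlap_eq (by omega) (by omega) (by omega) (by omega)
    have c1 : ¬ Q.h ≤ 1 := by omega
    have c2 : ¬ (Q.mu Q.h + 1 = Q.overlap ∧ Q.lam Q.h = Q.overlap) := by omega
    have c3 : Q.overlap < Q.lam Q.h := by omega
    rw [lastPoint, removeLast]
    simp only [if_neg c1, if_neg c2, if_pos c3]
    refine ⟨by rw [h3], rfl, fun i hi => ?_, ?_, fun i hi => h4 i hi⟩
    · simp only [Function.update_of_ne hi.ne]; exact h2 i hi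
    · simp [h3]

/-- The last row is reduced to one point, which lies below row `r` and hence in the overlap column;
its removal deletes the row. -/
theorem IsStage.step_up (hP : P.mu r < P.lam r) (h : IsStage P Q (r + 1) (P.mu (r + 1) + 1))
    (hr : 1 ≤ r) (hm : P.mu r ≤ P.mu (r + 1)) (hl : P.mu (r + 1) < P.lam r) :
    Q.lastPoint = (r + 1, P.mu (r + 1) + 1) ∧ IsStage P Q.removeLast r (P.lam r) := by
  obtain ⟨h1, h2, h3, h4⟩ := h
  have e1 := h2 r (by omega)
  have e2 := h4 r (by omega)
  have e3 := h4 (r + 1) le_rfl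
  have e0 : Q.h - 1 = r := by omega
  have ho : Q.overlap = _ := overlap_eq (by rw [e0]; omega) (by rw [e0, h1]; omega)
    (by rw [e0, h1]; omega) (by rw [h1]; omega)
  rw [e0, h1] at ho
  have c1 : ¬ Q.h ≤ 1 := by omega
  have c2 : Q.mu Q.h + 1 = Q.overlap ∧ Q.lam Q.h = Q.overlap := by rw [h1]; omega
  rw [lastPoint, removeLast]
  simp only [if_neg c1, if_pos c2]
  refine ⟨by rw [h1]; congr 1; omega, e0, fun i hi => h2 i (by omega), h2 r (by omega),
    fun i hi => h4 i (by omega)⟩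

/-- If row `r + 1` starts to the west of row `r`, its leftmost point is removed before the
next one. -/
theorem IsStage.step_east (hP : P.mu r < P.lam r) (h : IsStage P Q (r + 1) (P.mu r + 1))
    (hr : 1 ≤ r) (hm : P.mu (r + 1) < P.mu r) :
    Q.lastPoint = (r + 1, P.mu (r + 1) + 1) ∧
      Q.removeLast.lastPoint = (r + 1, P.mu (r + 1) + 2) := by
  obtain ⟨h1, h2, h3, h4⟩ := h
  have e1 := h2 r (by omega)
  have e2 := h4 r (by omega)
  have e3 := h4 (r + 1) le_rfl
  have e0 : Q.h - 1 = r := by omega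
  have ho : Q.overlap = _ := overlap_eq (by rw [e0]; omega) (by rw [e0, h1]; omega)
    (by rw [e0, h1]; omega) (by rw [h1]; omega)
  rw [e0, h1] at ho
  have hQ : Q.removeLast = { Q with mu := Function.update Q.mu Q.h (Q.mu Q.h + 1) } := by
    rw [removeLast, if_neg (by omega), if_neg (by rw [h1]; omega), if_neg (by rw [h1]; omega)]
  constructor
  · rw [lastPoint, if_neg (by omega), if_neg (by rw [h1]; omega), if_neg (by rw [h1]; omega),
      h1, e3]
  · have f1 : Q.removeLast.h = r + 1 := by rw [hQ, ← h1]
    have f2 : Q.removeLast.lam = Q.lam := by rw [hQ]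
    have f3 : Q.removeLast.mu r = Q.mu r := by
      rw [hQ]; simp only []; rw [Function.update_of_ne (by omega)]
    have f4 : Q.removeLast.mu (r + 1) = Q.mu (r + 1) + 1 := by
      rw [hQ, h1]; simp
    have f0 : Q.removeLast.h - 1 = r := by omega
    have ho' : Q.removeLast.overlap = _ :=
      overlap_eq (by rw [f0, f2]; omega) (by rw [f0, f1, f2]; omega)
        (by rw [f0, f1, f2]; omega) (by rw [f1, f2]; omega)
    rw [f0, f1] at ho'
    rw [lastPoint, if_neg (by omega), f1, f4, f2, e3]
    -- The next point goes as the only point of its row in the first case, as the leftmost one in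
    -- the second.
    by_cases hlt : P.mu (r + 1) + 1 = P.mu r
    · rw [if_pos (by omega)]; congr 1; omega
    · rw [if_neg (by omega), if_neg (by omega)]

/-- The first column of row `r` that row `r - 1` (if any) meets or lies to the west of. -/
def firstShared (P : RowData) (r : ℕ) : ℕ :=
  if r = 1 then P.mu 1 + 1 else max (P.mu (r - 1)) (P.mu r) + 1

theorem Reaches.west (hP : P.IsShiftedPartition) (hc : IsConnectedDiagram P.diagram)
    (h1 : 1 ≤ r) (h2 : r ≤ P.h) (h : P.Reaches k r (s + 1)) (hs : P.firstShared r ≤ s)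
    (hl : s + 1 ≤ P.lam r) :
    (removeLast^[k] P).lastPoint = (r, s + 1) ∧ P.Reaches (k + 1) r s := by
  have hr : r = 1 ∧ P.mu r < s ∨ 2 ≤ r ∧ P.mu (r - 1) < P.lam (r - 1) ∧
      P.mu r < P.lam (r - 1) ∧ P.mu (r - 1) < s ∧ P.mu r < s := by
    rw [firstShared] at hs
    split_ifs at hs with h
    · subst h; omega
    · obtain ⟨q, rfl⟩ : ∃ q, r = q + 1 := ⟨r - 1, by omega⟩
      have := rows_overlap hP hc (r := q) (by omega) h2
      have := hP.row (r := q) (by omega) (by omega)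
      simp only [Nat.add_sub_cancel] at hs ⊢
      omega
  obtain ⟨e1, e2⟩ := h.stage.step_west hr
  refine ⟨e1, ?_, ?_⟩
  · rw [Function.iterate_succ_apply']; exact e2
  · have := card_upTo_west (P := P) (r := r) (s := s) (mk_mem_diagram.2 (by omega))
    have := h.count
    omega

theorem Reaches.up (hP : P.IsShiftedPartition) (hc : IsConnectedDiagram P.diagram)
    (h1 : 1 ≤ r) (h2 : r + 1 ≤ P.h) (hm : P.mu r ≤ P.mu (r + 1))
    (h : P.Reaches k (r + 1) (P.mu (r + 1) + 1)) :
    (removeLast^[k] P).lastPoint = (r + 1, P.mu (r + 1) + 1) ∧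
      P.Reaches (k + 1) r (P.lam r) := by
  have ho := rows_overlap hP hc h1 h2
  have hr := hP.row (r := r) h1 (by omega)
  have hr' := hP.row (r := r + 1) (by omega) h2
  obtain ⟨e1, e2⟩ := h.stage.step_up hr.2 h1 hm ho.2
  refine ⟨e1, ?_, ?_⟩
  · rw [Function.iterate_succ_apply']; exact e2
  · have := card_upTo_west (P := P) (r := r + 1) (s := P.mu (r + 1))
      (mk_mem_diagram.2 (by omega))
    have := h.count
    rw [upTo_row_start le_rfl] at *
    omega

theorem Reaches.row (hP : P.IsShiftedPartition) (hc : IsConnectedDiagram P.diagram)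
    (h1 : 1 ≤ r) (h2 : r ≤ P.h) (h : P.Reaches k r (P.lam r)) (hs : P.firstShared r ≤ s)
    (hs' : s ≤ P.lam r) : ∃ k, P.Reaches k r s := by
  obtain ⟨d, hd⟩ : ∃ d, s + d = P.lam r := ⟨P.lam r - s, by omega⟩
  induction d generalizing s with
  | zero => obtain rfl : s = P.lam r := hd; exact ⟨k, h⟩
  | succ d ih =>
    obtain ⟨k', hk'⟩ := ih (s := s + 1) (by omega) (by omega) (by omega)
    exact ⟨k' + 1, (hk'.west hP hc h1 h2 hs (by omega)).2⟩

theorem Reaches.lastPoint (hP : P.IsShiftedPartition) (hc : IsConnectedDiagram P.diagram)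
    (hmono : ∀ r, 1 ≤ r → r + 1 ≤ P.h → P.mu r ≤ P.mu (r + 1)) (h : P.Reaches k r s)
    (hD : (r, s) ∈ P.diagram) : (removeLast^[k] P).lastPoint = (r, s) := by
  rw [mk_mem_diagram] at hD
  obtain ⟨⟨h1, h2⟩, h3, h4⟩ := hD
  by_cases hs : s = P.mu r + 1
  · rcases h1.eq_or_lt with rfl | hr
    · rw [RowData.lastPoint, if_pos h.stage.h_eq.le, h.stage.lam_last]
    · obtain ⟨q, rfl⟩ : ∃ q, r = q + 1 := ⟨r - 1, by omega⟩
      subst hs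
      exact (h.up hP hc (by omega) h2 (hmono q (by omega) h2)).1
  · obtain ⟨q, rfl⟩ : ∃ q, s = q + 1 := ⟨s - 1, by omega⟩
    refine (h.west hP hc h1 h2 ?_ h4).1
    rw [firstShared]
    split_ifs with hr
    · subst hr; omega
    · have := hmono (r - 1) (by omega) (by omega)
      rw [show r - 1 + 1 = r by omega] at this
      omega

theorem isMinimalMove_of_adjacent {i j j' : ℕ} (h : (i, j) ∈ P.diagram)
    (h' : (i, j') ∈ P.diagram) (hj : j' = j + 1 ∨ j = j' + 1) :
    IsMinimalMove P.diagram (i, j) (i, j') := by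
  refine ⟨h, h', Or.inl rfl, ?_⟩
  rintro ⟨p, q⟩ - hpq
  rw [Set.uIcc, Set.mem_Icc] at hpq
  simp only [Prod.mk_inf_mk, Prod.mk_sup_mk, Prod.mk_le_mk, Prod.mk.injEq] at hpq ⊢
  omega

/-- Induction from the last row upward. If row `r + 1` began west of row `r`, it would be cut back
from the east to the overlap column `P.mu r + 1` and then lose its leftmost point before the eastern
neighbour of that point. The move between these two would be good and point eastward. -/
theorem mono_and_reaches (hP : P.IsShiftedPartition) (hc : IsConnectedDiagram P.diagram)
    (hw : ∀ c c', P.IsGoodMove c c' → c.1 = c'.1 → c'.2 < c.2) (d : ℕ) :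
    ∀ r, r + d = P.h → 1 ≤ r →
      (r + 1 ≤ P.h → P.mu r ≤ P.mu (r + 1)) ∧ ∃ k, P.Reaches k r (P.lam r) := by
  induction d with
  | zero =>
    rintro r rfl -
    exact ⟨fun h => by omega, 0, Reaches.init P⟩
  | succ d ih =>
    intro r hr h1
    have h2 : r + 1 ≤ P.h := by omega
    obtain ⟨k, hk⟩ := (ih (r + 1) (by omega) (by omega)).2
    have ho := rows_overlap hP hc h1 h2
    have hr1 := hP.row (r := r) h1 (by omega)
    have hr2 := hP.row (r := r + 1) (by omega) h2
    have hfs : P.firstShared (r + 1) = max (P.mu r) (P.mu (r + 1)) + 1 := by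
      rw [firstShared, if_neg (by omega), Nat.add_sub_cancel]
    have hm : P.mu r ≤ P.mu (r + 1) := by
      by_contra! hlt
      obtain ⟨k', hk'⟩ := hk.row (s := P.mu r + 1) hP hc (by omega) h2 (by omega) (by omega)
      obtain ⟨e1, e2⟩ := hk'.stage.step_east hr1.2 h1 hlt
      have m1 : (r + 1, P.mu (r + 1) + 1) ∈ P.diagram := mk_mem_diagram.2 (by omega)
      have m2 : (r + 1, P.mu (r + 1) + 2) ∈ P.diagram := mk_mem_diagram.2 (by omega)
      -- Two points are left, so the removals `k'` and `k' + 1` both take place within the range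
      -- allowed by `Precedes`.
      have hcard : 1 < (P.upTo (r + 1) (P.mu r + 1)).card := by
        refine Finset.one_lt_card.2 ⟨_, Finset.mem_filter.2 ⟨m1, Or.inr ?_⟩, _,
          Finset.mem_filter.2 ⟨m2, Or.inr ?_⟩, by simp⟩ <;>
        simp only [true_and] <;> omega
      have := hw _ _ ⟨isMinimalMove_of_adjacent m1 m2 (by omega), k', k' + 1, by omega,
        by have := hk'.count; omega, e1.symm,
        by rw [Function.iterate_succ_apply']; exact e2.symm⟩ rfl
      simp at this
    refine ⟨fun _ => hm, ?_⟩
    obtain ⟨k', hk'⟩ := hk.row (s := P.mu (r + 1) + 1) hP hc (by omega) h2 (by omega) (by omega)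
    exact ⟨k' + 1, (hk'.up hP hc h1 h2 hm).2⟩

/-- The lexicographic order on lattice points. -/
def LexLT (c c' : ℕ × ℕ) : Prop := c.1 < c'.1 ∨ c.1 = c'.1 ∧ c.2 < c'.2

theorem card_upTo_lt {c c' : ℕ × ℕ} (h' : c' ∈ P.diagram) (hlt : LexLT c c') :
    (P.upTo c.1 c.2).card < (P.upTo c'.1 c'.2).card := by
  apply Finset.card_lt_card
  rw [Finset.ssubset_iff_of_subset]
  · refine ⟨c', Finset.mem_filter.2 ⟨h', Or.inr ⟨rfl, le_rfl⟩⟩, ?_⟩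
    simp only [upTo, Finset.mem_filter, not_and]
    rw [LexLT] at hlt
    intro _; omega
  · intro p
    simp only [upTo, Finset.mem_filter]
    rw [LexLT] at hlt
    rintro ⟨hp, hp'⟩
    exact ⟨hp, by omega⟩

/-- The combinatorial content of the first two conditions for compatibility: the rows overlap,
their starting columns increase weakly southward, and the order of removal is the reverse of the
lexicographic order. -/
structure IsLexOrdered (P : RowData) : Prop where
  row : ∀ i, 1 ≤ i → i ≤ P.h → i ≤ P.mu i + 1 ∧ P.mu i < P.lam i
  mono : ∀ r, 1 ≤ r → r + 1 ≤ P.h → P.mu r ≤ P.mu (r + 1)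
  overlap : ∀ r, 1 ≤ r → r + 1 ≤ P.h → P.mu (r + 1) < P.lam r
  precedes_iff : ∀ c c', P.Precedes c c' ↔ c ∈ P.diagram ∧ c' ∈ P.diagram ∧ LexLT c c'

theorem LexLT.trichotomy {c c' : ℕ × ℕ} : LexLT c c' ∨ c = c' ∨ LexLT c' c := by
  obtain ⟨i, j⟩ := c
  obtain ⟨i', j'⟩ := c'
  simp only [LexLT, Prod.mk.injEq]
  omega

/-- The removal time `K c` is the number of points lexicographically after `c`. So `K` reverses the
order and is a bijection onto the times below the number of points; surjectivity is needed since
`Precedes` speaks of times. -/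
theorem isLexOrdered (hP : P.IsShiftedPartition) (hc : IsConnectedDiagram P.diagram)
    (hw : ∀ c c', P.IsGoodMove c c' → c.1 = c'.1 → c'.2 < c.2) : P.IsLexOrdered := by
  have hmono : ∀ r, 1 ≤ r → r + 1 ≤ P.h → P.mu r ≤ P.mu (r + 1) := fun r h1 h2 =>
    (mono_and_reaches hP hc hw (P.h - r) r (by omega) h1).1 h2
  have hreach : ∀ c ∈ P.diagram, ∃ k, P.Reaches k c.1 c.2 := by
    rintro ⟨r, s⟩ hD
    rw [mk_mem_diagram] at hD
    simp only
    obtain ⟨k, hk⟩ := (mono_and_reaches hP hc hw (P.h - r) r (by omega) hD.1.1).2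
    refine hk.row hP hc hD.1.1 hD.1.2 ?_ hD.2.2
    rw [firstShared]
    split_ifs with hr
    · subst hr; omega
    · have := hmono (r - 1) (by omega) (by omega)
      rw [show r - 1 + 1 = r by omega] at this
      omega
  choose! K hK using hreach
  have hpos : ∀ c ∈ P.diagram, 0 < (P.upTo c.1 c.2).card := fun c hD =>
    Finset.card_pos.2 ⟨c, Finset.mem_filter.2 ⟨hD, Or.inr ⟨rfl, le_rfl⟩⟩⟩
  have hlt : ∀ c ∈ P.diagram, ∀ c' ∈ P.diagram, LexLT c c' → K c' < K c := by
    intro c hD c' hD' h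
    have := card_upTo_lt hD' h
    have := (hK c hD).count
    have := (hK c' hD').count
    omega
  have hinj : Set.InjOn K P.diagram := by
    intro c hD c' hD' h
    rcases LexLT.trichotomy (c := c) (c' := c') with h' | h' | h'
    · have := hlt c hD c' hD' h'; omega
    · exact h'
    · have := hlt c' hD' c hD h'; omega
  have himage : P.diagram.image K = Finset.range P.diagram.card := by
    apply Finset.eq_of_subset_of_card_le
    · intro k hk
      obtain ⟨c, hD, rfl⟩ := Finset.mem_image.1 hk
      have := (hK c hD).count
      have := hpos c hD
      rw [Finset.mem_range]; omega
    · rw [Finset.card_image_of_injOn hinj, Finset.card_range]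
  have hlast : ∀ c ∈ P.diagram, (removeLast^[K c] P).lastPoint = c := fun c hD =>
    (hK c hD).lastPoint hP hc hmono hD
  refine ⟨fun i h1 h2 => hP.row h1 h2, hmono, fun r h1 h2 => (rows_overlap hP hc h1 h2).2, ?_⟩
  intro c c'
  constructor
  · rintro ⟨k, l, hkl, hl, rfl, rfl⟩
    have hk' := Finset.mem_range.2 (hkl.trans hl)
    have hl' := Finset.mem_range.2 hl
    rw [← himage] at hk' hl'
    obtain ⟨c', hD', rfl⟩ := Finset.mem_image.1 hk'
    obtain ⟨c, hD, rfl⟩ := Finset.mem_image.1 hl'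
    rw [hlast c hD, hlast c' hD']
    refine ⟨hD, hD', ?_⟩
    rcases LexLT.trichotomy (c := c) (c' := c') with h' | h' | h'
    · exact h'
    · subst h'; omega
    · have := hlt c' hD' c hD h'; omega
  · rintro ⟨hD, hD', h⟩
    refine ⟨K c', K c, hlt c hD c' hD' h, ?_, (hlast c' hD').symm, (hlast c hD).symm⟩
    have := (hK c hD).count
    have := hpos c hD
    omega

end RowData

/-! ### Good moves, rectangles and linear quotients. -/

theorem pointExp_apply {n : ℕ} (c : ℕ × ℕ) (k : Fin n) : pointExp n c k =
    (if (k : ℕ) + 1 = c.1 then 1 else 0) + (if (k : ℕ) + 1 = c.2 then 1 else 0) := rfl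

namespace RowData

variable {P : RowData} {n : ℕ}

namespace IsLexOrdered

variable (hP : P.IsLexOrdered)
include hP

theorem mu_le {r s : ℕ} (h1 : 1 ≤ r) (hrs : r ≤ s) (hs : s ≤ P.h) : P.mu r ≤ P.mu s := by
  induction s, hrs using Nat.le_induction with
  | base => exact le_rfl
  | succ s hrs ih => exact (ih (by omega)).trans (hP.mono s (by omega) hs)

theorem le_of_mem {i j : ℕ} (h : (i, j) ∈ P.diagram) : 1 ≤ i ∧ i ≤ j := by
  rw [mk_mem_diagram] at h
  have := hP.row i h.1.1 h.1.2
  omega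

/-- If `(i, j)` is a point of the diagram, then so are `(p, j)` and `(p, j')` for `p ≤ i` and
`j' ≤ j` as soon as row `p` extends far enough to the east and row `i` to the west. -/
theorem mem_of_corners {p i j j' : ℕ} (h : (i, j') ∈ P.diagram) (h' : (p, j) ∈ P.diagram)
    (hp : p ≤ i) (hj : j' ≤ j) : (p, j') ∈ P.diagram := by
  rw [mk_mem_diagram] at *
  have := hP.mu_le h'.1.1 hp h.1.2
  omega

/-- Rows are intervals, so minimal horizontal moves have length one. Columns may have gaps, since
`lam` need not be monotone. -/
theorem isGoodMove_iff {c c' : ℕ × ℕ} : P.IsGoodMove c c' ↔ c ∈ P.diagram ∧ c' ∈ P.diagram ∧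
    (c.1 = c'.1 ∧ c'.2 + 1 = c.2 ∨
      c.2 = c'.2 ∧ c'.1 < c.1 ∧ ∀ r, c'.1 < r → r < c.1 → (r, c.2) ∉ P.diagram) := by
  obtain ⟨i, j⟩ := c
  obtain ⟨i', j'⟩ := c'
  rw [IsGoodMove, hP.precedes_iff]
  simp only [LexLT]
  constructor
  · rintro ⟨⟨h, h', hq, hmin⟩, -, -, hlt⟩
    refine ⟨h, h', ?_⟩
    simp only [IsQuasiBorelMove] at hq
    rcases hq with rfl | rfl
    · left
      by_contra hne
      rw [mk_mem_diagram] at h h'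
      have := hmin (i, j' + 1) (mk_mem_diagram.2 (by omega)) (by
        rw [Set.uIcc, Set.mem_Icc]
        simp only [Prod.mk_inf_mk, Prod.mk_sup_mk, Prod.mk_le_mk]
        omega)
      simp only [Prod.mk.injEq] at this
      omega
    · right
      refine ⟨rfl, by omega, fun r h1 h2 hr => ?_⟩
      have := hmin (r, j) hr (by
        rw [Set.uIcc, Set.mem_Icc]
        simp only [Prod.mk_inf_mk, Prod.mk_sup_mk, Prod.mk_le_mk]
        omega)
      simp only [Prod.mk.injEq] at this
      omega
  · rintro ⟨h, h', ⟨rfl, rfl⟩ | ⟨rfl, hlt, hno⟩⟩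
    · exact ⟨isMinimalMove_of_adjacent h h' (by omega), h', h, by omega⟩
    · refine ⟨⟨h, h', Or.inr rfl, ?_⟩, h', h, by omega⟩
      rintro ⟨p, q⟩ hD hpq
      rw [Set.uIcc, Set.mem_Icc] at hpq
      simp only [Prod.mk_inf_mk, Prod.mk_sup_mk, Prod.mk_le_mk, Prod.mk.injEq] at hpq ⊢
      obtain rfl : q = j := by omega
      by_contra hne
      exact hno p (by omega) (by omega) hD

theorem west_isGoodMove {i j : ℕ} (h : (i, j + 1) ∈ P.diagram) (h' : (i, j) ∈ P.diagram) :
    P.IsGoodMove (i, j + 1) (i, j) :=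
  hP.isGoodMove_iff.2 ⟨h, h', Or.inl ⟨rfl, rfl⟩⟩

theorem exists_north {p r j : ℕ} (hp : (p, j) ∈ P.diagram) (hr : (r, j) ∈ P.diagram)
    (hpr : p < r) : ∃ q, p ≤ q ∧ q < r ∧ P.IsGoodMove (r, j) (q, j) := by
  classical
  have hq : (Nat.findGreatest (fun q => (q, j) ∈ P.diagram) (r - 1), j) ∈ P.diagram :=
    Nat.findGreatest_spec (P := fun q => (q, j) ∈ P.diagram) (m := p) (by omega) hp
  have h1 := Nat.findGreatest_le (P := fun q => (q, j) ∈ P.diagram) (r - 1)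
  have h2 : p ≤ Nat.findGreatest (fun q => (q, j) ∈ P.diagram) (r - 1) :=
    Nat.le_findGreatest (by omega) hp
  refine ⟨_, h2, by omega, hP.isGoodMove_iff.2 ⟨hr, hq, Or.inr ⟨rfl, by simp only; omega, ?_⟩⟩⟩
  intro q h3 h4
  exact Nat.findGreatest_is_greatest h3 (by simp only at h4; omega)

theorem north_unique {c d d' : ℕ × ℕ} (h : P.IsGoodMove c d) (h' : P.IsGoodMove c d')
    (hd : c.2 = d.2) (hd' : c.2 = d'.2) : d = d' := by
  obtain ⟨-, hD, ⟨h1, h2⟩ | ⟨-, h2, h3⟩⟩ := hP.isGoodMove_iff.1 h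
  · omega
  obtain ⟨-, hD', ⟨h4, h5⟩ | ⟨-, h5, h6⟩⟩ := hP.isGoodMove_iff.1 h'
  · omega
  rcases lt_trichotomy d.1 d'.1 with hlt | heq | hlt
  · exact absurd (by rw [hd']; exact hD') (h3 _ hlt h5)
  · exact Prod.ext heq (by omega)
  · exact absurd (by rw [hd]; exact hD) (h6 _ hlt h2)

theorem hSegment_iff {i j : ℕ} :
    P.HSegment i j ↔ (i, j) ∈ P.diagram ∧ (i, j + 1) ∈ P.diagram := by
  constructor
  · rintro ⟨⟨i, j⟩, ⟨i', j'⟩, h, rfl, h', h1, h2⟩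
    obtain ⟨hD, hD', h | h⟩ := hP.isGoodMove_iff.1 h
    · simp only at *
      subst h'
      obtain ⟨-, rfl⟩ := h
      rw [max_eq_left (by omega)] at h2
      rw [min_eq_right (by omega)] at h1
      obtain rfl : j = j' := by omega
      exact ⟨hD', hD⟩
    · simp only at *
      omega
  · rintro ⟨h, h'⟩
    exact ⟨_, _, hP.west_isGoodMove h' h, rfl, rfl, by simp, by simp⟩

/-- Vertical good moves bridge the gaps of a column, so they cover it from its first to its last
point. The segment below row `i` lies on the move from the nearest point south of row `i`. -/
theorem vSegment_iff {i j : ℕ} : P.VSegment i j ↔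
    (∃ p ≤ i, (p, j) ∈ P.diagram) ∧ ∃ r, i < r ∧ (r, j) ∈ P.diagram := by
  classical
  constructor
  · rintro ⟨⟨i', j⟩, ⟨i'', j'⟩, h, rfl, h', h1, h2⟩
    obtain ⟨hD, hD', h | h⟩ := hP.isGoodMove_iff.1 h
    · simp only at *
      omega
    · simp only at *
      subst h'
      exact ⟨⟨i'', by omega, hD'⟩, i', by omega, hD⟩
  · rintro ⟨⟨p, hp, hpD⟩, hex⟩
    obtain ⟨h1, h2⟩ := Nat.find_spec hex
    obtain ⟨q, h3, h4, h5⟩ := hP.exists_north hpD h2 (by omega)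
    refine ⟨_, _, h5, rfl, rfl, ?_, ?_⟩
    · simp only [inf_le_iff]
      right
      by_contra! hlt
      exact Nat.find_min hex h4 ⟨hlt, (hP.isGoodMove_iff.1 h5).2.1⟩
    · simp only [le_sup_iff]
      omega

/-- The bounded components are the rectangles of width one whose right side is a good move. -/
theorem isTwoCell_iff {Z : LatticeRect} : P.IsTwoCell Z ↔ Z.right = Z.left + 1 ∧
    P.IsGoodMove (Z.bot, Z.right) (Z.top, Z.right) ∧ (Z.bot, Z.left) ∈ P.diagram := by
  obtain ⟨t, b, l, r⟩ := Z
  simp only [IsTwoCell, hP.hSegment_iff, hP.vSegment_iff]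
  constructor
  · rintro ⟨htb, hlr, hH, hV⟩
    obtain rfl : r = l + 1 := by
      -- In a wider rectangle, column `l + 1` would meet the top and the bottom row and so cut the
      -- interior.
      by_contra hne
      have h1 := hH (l + 1) (by omega) (by omega)
      exact (hV t le_rfl htb).2.2 (l + 1) (by omega) (by omega)
        ⟨⟨t, le_rfl, h1.1.1⟩, b, htb, h1.2.1.1⟩
    obtain ⟨⟨htl, htr⟩, ⟨hbl, hbr⟩, hno⟩ := hH l le_rfl (by omega)
    obtain ⟨q, h1, h2, h3⟩ := hP.exists_north htr hbr htb
    obtain rfl : q = t := by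
      -- A point inside the right side would have a western neighbour in the diagram, and the edge
      -- between them would cut the interior.
      by_contra hne
      have hq := (hP.isGoodMove_iff.1 h3).2.1
      exact hno q (by omega) h2 ⟨hP.mem_of_corners hbl hq h2.le (by omega), hq⟩
    exact ⟨rfl, h3, hbl⟩
  · rintro ⟨rfl, hg, hbl⟩
    obtain ⟨hbr, htr, h | ⟨-, htb, hno⟩⟩ := hP.isGoodMove_iff.1 hg
    · simp only at h; omega
    simp only at *
    have htl := hP.mem_of_corners hbl htr htb.le (by omega)
    refine ⟨htb, by omega, fun j h1 h2 => ?_, fun i h1 h2 => ?_⟩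
    · obtain rfl : j = l := by omega
      exact ⟨⟨htl, htr⟩, ⟨hbl, hbr⟩, fun i h3 h4 h5 => hno i h3 h4 h5.2⟩
    · exact ⟨⟨⟨t, h1, htl⟩, b, h2, hbl⟩, ⟨⟨t, h1, htr⟩, b, h2, hbr⟩, fun j h3 h4 => by omega⟩

/-- A point that is not the first one is the start of a good move. -/
theorem exists_isGoodMove {i j p q : ℕ} (h : (i, j) ∈ P.diagram) (h' : (p, q) ∈ P.diagram)
    (hlt : LexLT (p, q) (i, j)) :
    ((i, j - 1) ∈ P.diagram ∧ P.IsGoodMove (i, j) (i, j - 1)) ∨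
      j = P.mu i + 1 ∧ ∃ r < i, P.IsGoodMove (i, j) (r, j) := by
  have hij := mk_mem_diagram.1 h
  by_cases hj : j = P.mu i + 1
  · right
    refine ⟨hj, ?_⟩
    have hi : 1 < i := by
      by_contra hi
      rw [mk_mem_diagram] at h'
      simp only [LexLT] at hlt
      obtain rfl : p = i := by omega
      omega
    obtain ⟨r, rfl⟩ : ∃ r, i = r + 1 := ⟨i - 1, by omega⟩
    have hr := hP.mono r (by omega) (by omega)
    have hr' := hP.overlap r (by omega) (by omega)
    obtain ⟨q, -, h2, h3⟩ := hP.exists_north (p := r) (j := j)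
      (mk_mem_diagram.2 (by omega)) h (by omega)
    exact ⟨q, h2, h3⟩
  · left
    obtain ⟨k, rfl⟩ : ∃ k, j = k + 1 := ⟨j - 1, by omega⟩
    have : (i, k) ∈ P.diagram := mk_mem_diagram.2 (by omega)
    exact ⟨this, hP.west_isGoodMove h this⟩

/-- If `(i, j)` is the westernmost point of row `i`, then no earlier row meets column `i`, unless
`i = j`. -/
theorem not_mem_of_compatible (hn : ∀ i ∈ Finset.Icc 1 P.h, P.lam i ≤ n)
    (hX : ∀ c ∈ P.diagram, {c' | P.IsGoodMove c c'}.ncard = 2 ↔ (P.exchangeSet n c).ncard = 2)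
    {i p r : ℕ} (h : (i, P.mu i + 1) ∈ P.diagram)
    (hr : P.IsGoodMove (i, P.mu i + 1) (r, P.mu i + 1)) (hri : r < i) (hi : i < P.mu i + 1)
    (hp : p < i) : (p, i) ∉ P.diagram := by
  intro hpD
  have hij := mk_mem_diagram.1 h
  have hln := hn i (Finset.mem_Icc.2 hij.1)
  have hrD := (hP.isGoodMove_iff.1 hr).2.1
  have hr1 := hP.le_of_mem hrD
  have hp1 := hP.le_of_mem hpD
  -- With `j = P.mu i + 1`, the point `(r, j)` exchanges `x_i` for `x_r`, and `(p, i)` exchanges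
  -- `x_j` for `x_p`. The exchange set then has two elements, but a westernmost point starts at most
  -- one good move.
  have hex : P.exchangeSet n (i, P.mu i + 1) =
      {(⟨i - 1, by omega⟩ : Fin n), ⟨P.mu i, by omega⟩} := by
    ext k
    simp only [exchangeSet, Set.mem_ofPred_eq, Set.mem_insert_iff, Set.mem_singleton_iff,
      Fin.ext_iff]
    constructor
    · rintro ⟨l, hlk, c', -, he, -⟩
      have := DFunLike.congr_fun he k
      simp only [Finsupp.add_apply, pointExp_apply, Finsupp.single_eq_same,
        Finsupp.single_eq_of_ne hlk.symm] at this
      split_ifs at this <;> omega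
    · rintro (hk | hk)
      · refine ⟨⟨r - 1, by omega⟩, by rw [Ne, Fin.ext_iff]; simp only; omega, _, hrD, ?_,
          (hP.precedes_iff _ _).2 ⟨hrD, h, Or.inl hri⟩⟩
        ext m
        simp only [Finsupp.add_apply, pointExp_apply, Finsupp.single_apply, Fin.ext_iff]
        split_ifs <;> omega
      · refine ⟨⟨p - 1, by omega⟩, by rw [Ne, Fin.ext_iff]; simp only; omega, _, hpD, ?_,
          (hP.precedes_iff _ _).2 ⟨hpD, h, Or.inl hp⟩⟩
        ext m
        simp only [Finsupp.add_apply, pointExp_apply, Finsupp.single_apply, Fin.ext_iff]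
        split_ifs <;> omega
  have h2 : {c' | P.IsGoodMove (i, P.mu i + 1) c'}.ncard = 2 := by
    rw [hX _ h, hex, Set.ncard_pair]
    rw [Ne, Fin.ext_iff]; simp only; omega
  have h1 : {c' | P.IsGoodMove (i, P.mu i + 1) c'} ⊆ {(r, P.mu i + 1)} := by
    intro c' hc'
    obtain ⟨-, hD', h3 | h3⟩ := hP.isGoodMove_iff.1 hc'
    · obtain ⟨i', j'⟩ := c'
      rw [mk_mem_diagram] at hD'
      simp only at h3
      obtain ⟨rfl, h4⟩ := h3
      omega
    · exact hP.north_unique hc' hr h3.1 rfl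
  have := Set.ncard_le_ncard h1
  rw [Set.ncard_singleton] at this
  omega

/-- Linear quotients: the colon ideals are generated by the variables of the good moves. -/
theorem exists_isGoodMove_inf_le (hn : ∀ i ∈ Finset.Icc 1 P.h, P.lam i ≤ n)
    (hX : ∀ c ∈ P.diagram, {c' | P.IsGoodMove c c'}.ncard = 2 ↔ (P.exchangeSet n c).ncard = 2)
    {c c' : ℕ × ℕ} (h : c ∈ P.diagram) (h' : c' ∈ P.diagram) (hlt : LexLT c' c) :
    ∃ d, P.IsGoodMove c d ∧ pointExp n c ⊓ pointExp n c' ≤ pointExp n d := by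
  obtain ⟨i, j⟩ := c
  obtain ⟨p, q⟩ := c'
  have hij := hP.le_of_mem h
  have hpq := hP.le_of_mem h'
  have hij' := mk_mem_diagram.1 h
  have hpq' := mk_mem_diagram.1 h'
  by_cases hjq : j = q
  · subst hjq
    simp only [LexLT] at hlt
    obtain ⟨r, -, hri, hr⟩ := hP.exists_north h' h (by omega)
    refine ⟨_, hr, fun k => ?_⟩
    simp only [Finsupp.inf_apply, pointExp_apply]
    split_ifs <;> omega
  rcases hP.exists_isGoodMove h h' hlt with ⟨hw, hgood⟩ | ⟨hj, r, hri, hgood⟩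
  -- The west step drops one factor `x_j`, which does not divide `x_p x_q`, as `p ≤ i < j` and `q ≠
  -- j`.
  · refine ⟨_, hgood, fun k => ?_⟩
    have hw' := hP.le_of_mem hw
    simp only [LexLT] at hlt
    simp only [Finsupp.inf_apply, pointExp_apply]
    split_ifs <;> omega
  · refine ⟨_, hgood, fun k => ?_⟩
    simp only [LexLT] at hlt
    have hpi : p < i := by
      by_contra hpi
      obtain rfl : p = i := by omega
      omega
    -- The north step drops one factor `x_i`, so `x_i` must not divide `x_p x_q`; compatibility
    -- excludes `q = i` off the diagonal.
    have : q ≠ i := by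
      rintro rfl
      subst hj
      exact hP.not_mem_of_compatible hn hX h hgood hri (by omega) hpi h'
    simp only [Finsupp.inf_apply, pointExp_apply]
    split_ifs <;> omega

end IsLexOrdered

end RowData

/-! ### Cellular differentials and elimination of leading terms. -/

open MvPolynomial in
theorem mem_of_X_dvd {K : Type*} [Field K] {n : ℕ} {k : Fin n} {f : MvPolynomial (Fin n) K}
    (h : X k ∣ f) : f ∈ Ideal.span (Set.range (X : Fin n → MvPolynomial (Fin n) K)) :=
  Ideal.mem_of_dvd _ h (Ideal.subset_span ⟨k, rfl⟩)

section CellularDiff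

open MvPolynomial

variable {K : Type*} [Field K] {n : ℕ} {ι κ τ : Type*} [Fintype κ]
  {α : ι → Fin n →₀ ℕ} {β : κ → Fin n →₀ ℕ} {ε : κ → ι → ℤ}

theorem cellularDiff_single (p : ι) (f : MvPolynomial (Fin n) K) (q : κ) :
    cellularDiff K α β ε (Finsupp.single p f) q =
      f * monomial (α p - β q) ((ε q p : ℤ) : K) := by
  classical
  rw [cellularDiff, Finsupp.linearCombination_single, Finsupp.smul_apply, Finsupp.finsetSum_apply,
    Finset.sum_eq_single q, Finsupp.single_eq_same, smul_eq_mul]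
  · intro b _ hb
    rw [Finsupp.single_eq_of_ne hb.symm]
  · simp

theorem cellularDiff_apply (u : ι →₀ MvPolynomial (Fin n) K) (q : κ) :
    cellularDiff K α β ε u q =
      ∑ p ∈ u.support, u p * monomial (α p - β q) ((ε q p : ℤ) : K) := by
  conv_lhs => rw [← Finsupp.sum_single u, Finsupp.sum, map_sum, Finsupp.finsetSum_apply]
  exact Finset.sum_congr rfl fun p _ => cellularDiff_single p (u p) q

/-- Only one basis element contributes to the coefficient at `q`. -/
theorem cellularDiff_apply_of_unique {u : ι →₀ MvPolynomial (Fin n) K} {q : κ} (p : ι)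
    (h : ∀ p', p' ≠ p → u p' ≠ 0 → ε q p' = 0) :
    cellularDiff K α β ε u q = u p * monomial (α p - β q) ((ε q p : ℤ) : K) := by
  rw [cellularDiff_apply]
  refine Finset.sum_eq_single p (fun p' hp' hne => ?_) fun hp => ?_
  · rw [h p' hne (Finsupp.mem_support_iff.1 hp'), Int.cast_zero, map_zero, mul_zero]
  · rw [Finsupp.notMem_support_iff.1 hp, zero_mul]

/-- Only two basis elements contribute to the coefficient at `q`. -/
theorem cellularDiff_apply_of_pair {u : ι →₀ MvPolynomial (Fin n) K} {q : κ} {p₁ p₂ : ι}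
    (hne : p₁ ≠ p₂) (h : ∀ p, p ≠ p₁ → p ≠ p₂ → u p ≠ 0 → ε q p = 0) :
    cellularDiff K α β ε u q = u p₁ * monomial (α p₁ - β q) ((ε q p₁ : ℤ) : K) +
      u p₂ * monomial (α p₂ - β q) ((ε q p₂ : ℤ) : K) := by
  rw [cellularDiff_apply]
  refine Finset.sum_eq_add p₁ p₂ hne (fun p hp hne => ?_) (fun hp => ?_) fun hp => ?_
  · rw [h p hne.1 hne.2 (Finsupp.mem_support_iff.1 hp), Int.cast_zero, map_zero, mul_zero]
  · rw [Finsupp.notMem_support_iff.1 hp, zero_mul]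
  · rw [Finsupp.notMem_support_iff.1 hp, zero_mul]

/-- Labels increase along incidences, so the exponents telescope to `α p - γ r` and only an identity
between integers remains. -/
theorem cellularDiff_comp_eq_zero [Fintype τ] {γ : τ → Fin n →₀ ℕ} {δ : τ → κ → ℤ}
    (hε : ∀ p q, ε q p ≠ 0 → β q ≤ α p) (hδ : ∀ q r, δ r q ≠ 0 → γ r ≤ β q)
    (h : ∀ p r, ∑ q, ε q p * δ r q = 0) (u : ι →₀ MvPolynomial (Fin n) K) :
    cellularDiff K β γ δ (cellularDiff K α β ε u) = 0 := by
  suffices cellularDiff K β γ δ ∘ₗ cellularDiff K α β ε = 0 from DFunLike.congr_fun this u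
  ext p r : 3
  simp only [LinearMap.comp_apply, Finsupp.lsingle_apply, LinearMap.zero_apply,
    Finsupp.zero_apply]
  rw [cellularDiff_apply, Finset.sum_subset (Finset.subset_univ _)]
  · calc _ = ∑ q, monomial (α p - γ r) (((ε q p * δ r q : ℤ)) : K) := by
          refine Finset.sum_congr rfl fun q _ => ?_
          rw [cellularDiff_single, one_mul, monomial_mul, Int.cast_mul]
          by_cases h1 : ε q p = 0
          · simp [h1]
          by_cases h2 : δ r q = 0
          · simp [h2]
          rw [tsub_add_tsub_cancel (hε p q h1) (hδ q r h2)]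
      _ = 0 := by rw [← map_sum, ← Int.cast_sum, h, Int.cast_zero, map_zero]
  · intro q _ hq
    rw [Finsupp.notMem_support_iff.1 hq, zero_mul]

theorem cellularDiff_isMultihomogeneous (hε : ∀ p q, ε q p ≠ 0 → β q ≤ α p) :
    IsMultihomogeneous α β (cellularDiff K α β ε) := by
  intro p q
  refine ⟨((ε q p : ℤ) : K), ?_⟩
  rw [cellularDiff_single, one_mul, monomial_mul, one_mul]
  by_cases h : ε q p = 0
  · simp [h]
  · rw [add_tsub_cancel_of_le (hε p q h)]

theorem cellularDiff_isMinimalMap (hε : ∀ p q, ε q p ≠ 0 → ∃ k, β q k < α p k) :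
    IsMinimalMap (cellularDiff K α β ε) := by
  rw [IsMinimalMap, cellularDiff, Finsupp.range_linearCombination, Submodule.span_le]
  rintro _ ⟨p, rfl⟩
  refine Submodule.sum_mem _ fun q _ => ?_
  rw [← mul_one (monomial _ _), ← smul_eq_mul, ← Finsupp.smul_single]
  refine Submodule.smul_mem_smul ?_ Submodule.mem_top
  by_cases h : ε q p = 0
  · simp [h]
  · obtain ⟨k, hk⟩ := hε p q h
    refine mem_of_X_dvd (k := k) (X_dvd_monomial.2 (Or.inr ?_))
    rw [Finsupp.tsub_apply]
    omega

end CellularDiff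

/-- Elimination of leading terms: a submodule that contains the leading terms of all elements of
a larger submodule equals the latter. -/
theorem Finsupp.le_of_elimination {R κ : Type*} [Ring R] (ρ : κ → ℕ)
    {N M : Submodule R (κ →₀ R)} (hN : N ≤ M)
    (step : ∀ m, ∀ u ∈ M, (∀ p, u p ≠ 0 → ρ p ≤ m) →
      ∃ v ∈ N, ∀ p, (u - v) p ≠ 0 → ρ p < m) : M ≤ N := by
  have key : ∀ m, ∀ u ∈ M, (∀ p, u p ≠ 0 → ρ p < m) → u ∈ N := by
    intro m
    induction m with
    | zero =>
      intro u _ h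
      have : u = 0 := by
        ext p
        by_contra hp
        exact absurd (h p hp) (Nat.not_lt_zero _)
      rw [this]
      exact N.zero_mem
    | succ m ih =>
      intro u hu h
      obtain ⟨v, hv, h'⟩ := step m u hu fun p hp => Nat.le_of_lt_succ (h p hp)
      rw [← sub_add_cancel u v]
      exact N.add_mem (ih _ (M.sub_mem hu (hN hv)) h') hv
  intro u hu
  refine key (u.support.sup ρ + 1) u hu fun p hp => Nat.lt_succ_of_le ?_
  exact Finset.le_sup (Finsupp.mem_support_iff.2 hp)

/-! ### Minimal generators and labels. -/

namespace RowData

variable {P : RowData} {n : ℕ} {a : Fin n →₀ ℕ}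

theorem mem_edges {e : (ℕ × ℕ) × (ℕ × ℕ)} : e ∈ P.edges ↔ P.IsGoodMove e.1 e.2 := by
  classical
  rw [edges, Finset.mem_filter, Finset.mem_product]
  exact ⟨fun h => h.2, fun h => ⟨⟨h.1.1, h.1.2.1⟩, h⟩⟩

/-- The position of a point in the lexicographic order. -/
def rank (n : ℕ) (c : ℕ × ℕ) : ℕ := c.1 * (n + 1) + c.2

/-- Columns are at most `n`, hence digits in base `n + 1`. -/
theorem rank_lt_of_lexLT {c c' : ℕ × ℕ} (h : c.2 ≤ n) (hlt : LexLT c c') :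
    rank n c < rank n c' := by
  rw [rank, rank]
  rcases hlt with hlt | ⟨h1, h2⟩
  · have := Nat.mul_le_mul_right (n + 1) (Nat.succ_le_of_lt hlt)
    rw [Nat.succ_eq_add_one, add_mul] at this
    omega
  · rw [h1]; omega

theorem lexLT_of_rank_lt {c c' : ℕ × ℕ} (h : c'.2 ≤ n) (hlt : rank n c < rank n c') :
    LexLT c c' := by
  rcases LexLT.trichotomy (c := c) (c' := c') with h' | rfl | h'
  · exact h'
  · exact absurd hlt (lt_irrefl _)
  · exact absurd (rank_lt_of_lexLT h h') hlt.not_gt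

theorem rank_inj {c c' : ℕ × ℕ} (h : c.2 ≤ n) (h' : c'.2 ≤ n) (he : rank n c = rank n c') :
    c = c' := by
  rcases LexLT.trichotomy (c := c) (c' := c') with hl | hl | hl
  · exact absurd (rank_lt_of_lexLT h hl) he.not_lt
  · exact hl
  · exact absurd (rank_lt_of_lexLT h' hl) he.not_gt

theorem col_le (hn : ∀ i ∈ Finset.Icc 1 P.h, P.lam i ≤ n) {c : ℕ × ℕ} (h : c ∈ P.diagram) :
    c.2 ≤ n := by
  rw [mem_diagram] at h
  exact h.2.2.trans (hn _ (Finset.mem_Icc.2 h.1))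

namespace IsLexOrdered

variable (hP : P.IsLexOrdered)
include hP

theorem lexLT_of_isGoodMove {c c' : ℕ × ℕ} (h : P.IsGoodMove c c') : LexLT c' c :=
  ((hP.precedes_iff _ _).1 h.2).2.2

/-- The monomials are quadratic and `i ≤ j` on the diagram, so `x_i x_j` determines its point; hence
all points give minimal generators. -/
theorem pointExp_le_iff (hn : ∀ i ∈ Finset.Icc 1 P.h, P.lam i ≤ n) {c c' : ℕ × ℕ}
    (h : c ∈ P.diagram) (h' : c' ∈ P.diagram) : pointExp n c ≤ pointExp n c' ↔ c = c' := by
  refine ⟨fun hle => ?_, fun he => he ▸ le_rfl⟩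
  have hc := col_le hn h
  obtain ⟨i, j⟩ := c
  obtain ⟨i', j'⟩ := c'
  have hij := hP.le_of_mem h
  have hij' := hP.le_of_mem h'
  simp only at hc
  have h1 := hle ⟨i - 1, by omega⟩
  have h2 := hle ⟨j - 1, by omega⟩
  simp only [pointExp_apply] at h1 h2
  rw [Prod.mk.injEq]
  split_ifs at h1 h2 <;> omega

omit hP in
theorem monomial_mem_ideal {K : Type*} [Field K] {e : Fin n →₀ ℕ} :
    MvPolynomial.monomial e (1 : K) ∈ P.ideal K n ↔ ∃ c ∈ P.diagram, pointExp n c ≤ e := by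
  classical
  have : P.ideal K n = Ideal.span ((fun s => MvPolynomial.monomial s (1 : K)) ''
      (pointExp n '' P.diagram)) := by rw [ideal, Set.image_image]
  rw [this, MvPolynomial.mem_ideal_span_monomial_image, MvPolynomial.support_monomial,
    if_neg one_ne_zero]
  simp

theorem minGenExps_ideal (hn : ∀ i ∈ Finset.Icc 1 P.h, P.lam i ≤ n) (K : Type*) [Field K] :
    minGenExps (P.ideal K n) = pointExp n '' P.diagram := by
  ext e
  simp only [minGenExps, monomial_mem_ideal, Set.mem_ofPred_eq]
  constructor
  · rintro ⟨⟨c, hc, hce⟩, hmin⟩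
    exact ⟨c, hc, le_antisymm hce (hmin ⟨c, hc, le_rfl⟩ hce)⟩
  · rintro ⟨c, hc, rfl⟩
    refine ⟨⟨c, hc, le_rfl⟩, ?_⟩
    rintro e ⟨c', hc', he⟩ hle
    rwa [(hP.pointExp_le_iff hn hc' hc).1 (he.trans hle)] at he

theorem dualIdeal_eq (hn : ∀ i ∈ Finset.Icc 1 P.h, P.lam i ≤ n) (K : Type*) [Field K] :
    dualIdeal a (P.ideal K n) =
      Ideal.span (Set.range fun c : P.Cell0 => MvPolynomial.monomial (P.label0 a c) (1 : K)) := by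
  rw [dualIdeal, hP.minGenExps_ideal hn, Set.image_image]
  congr 1
  ext f
  simp [label0]

theorem pointExp_le (hn : ∀ i ∈ Finset.Icc 1 P.h, P.lam i ≤ n) {K : Type*} [Field K]
    (ha : IsDetermined a (P.ideal K n)) {c : ℕ × ℕ} (h : c ∈ P.diagram) : pointExp n c ≤ a :=
  ha _ (by rw [hP.minGenExps_ideal hn]; exact ⟨c, h, rfl⟩)

/-- The label of a horizontal edge in row `i` is `x^a / x_i`. -/
theorem label1_west (hA : ∀ c ∈ P.diagram, pointExp n c ≤ a) {e : P.Cell1} {i j : ℕ}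
    (he : e.1 = ((i, j + 1), (i, j))) (k : Fin n) :
    P.label1 a e k = a k - if (k : ℕ) + 1 = i then 1 else 0 := by
  have h := hP.isGoodMove_iff.1 (mem_edges.1 e.2)
  rw [he] at h
  have h1 := hA _ h.1 k
  have h2 := hA _ h.2.1 k
  simp only [label1, he, Finsupp.sup_apply, Finsupp.tsub_apply, pointExp_apply] at *
  split_ifs at * <;> omega

/-- The label of a vertical edge in column `j` is `x^a / x_j`. -/
theorem label1_north (hA : ∀ c ∈ P.diagram, pointExp n c ≤ a) {e : P.Cell1} {i j r : ℕ}
    (he : e.1 = ((i, j), (r, j))) (k : Fin n) :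
    P.label1 a e k = a k - if (k : ℕ) + 1 = j then 1 else 0 := by
  have h := hP.isGoodMove_iff.1 (mem_edges.1 e.2)
  rw [he] at h
  have h1 := hA _ h.1 k
  have h2 := hA _ h.2.1 k
  simp only [label1, he, Finsupp.sup_apply, Finsupp.tsub_apply, pointExp_apply] at *
  split_ifs at * <;> omega

/-- The label of a rectangle is `x^a`. -/
theorem label2_eq (Z : P.Cell2) : P.label2 a Z = a := by
  obtain ⟨⟨t, b, l, r⟩, hZ⟩ := Z
  obtain ⟨hr, hg, hbl⟩ := hP.isTwoCell_iff.1 hZ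
  simp only at hr hg hbl
  subst hr
  obtain ⟨hbr, htr, h | ⟨-, htb, -⟩⟩ := hP.isGoodMove_iff.1 hg
  · simp only at h; omega
  simp only at htb
  have hb := hP.le_of_mem hbl
  rw [label2]
  apply le_antisymm
  · exact Finset.sup_le fun c _ => tsub_le_self
  · intro k
    -- Two opposite corners suffice: `t < b ≤ l` makes `x_b x_l` and `x_t x_{l+1}` coprime.
    have h1 := Finset.le_sup (f := fun c => a - pointExp n c)
      ((Finset.mem_filter (p := fun c => (t ≤ c.1 ∧ c.1 ≤ b) ∧ l ≤ c.2 ∧ c.2 ≤ l + 1)).2 ⟨hbl, ⟨htb.le, le_rfl⟩, le_rfl, Nat.le_succ l⟩)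
    have h2 := Finset.le_sup (f := fun c => a - pointExp n c)
      ((Finset.mem_filter (p := fun c => (t ≤ c.1 ∧ c.1 ≤ b) ∧ l ≤ c.2 ∧ c.2 ≤ l + 1)).2 ⟨htr, ⟨le_rfl, htb.le⟩, Nat.le_succ l, le_rfl⟩)
    replace h1 := h1 k
    replace h2 := h2 k
    simp only [Finsupp.tsub_apply, pointExp_apply] at h1 h2 ⊢
    split_ifs at h1 h2 <;> omega

omit hP in
theorem label1_le (e : P.Cell1) : P.label1 a e ≤ a := sup_le tsub_le_self tsub_le_self

theorem label1_lt (hn : ∀ i ∈ Finset.Icc 1 P.h, P.lam i ≤ n)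
    (hA : ∀ c ∈ P.diagram, pointExp n c ≤ a) (e : P.Cell1) : ∃ k, P.label1 a e k < a k := by
  obtain ⟨⟨⟨i, j⟩, i', j'⟩, he⟩ := e
  obtain ⟨hD, hD', h | h⟩ := hP.isGoodMove_iff.1 (mem_edges.1 he)
  all_goals
    have hij := hP.le_of_mem hD
    have hc := col_le hn hD
    simp only at h hc
  · obtain ⟨rfl, rfl⟩ := h
    refine ⟨⟨i - 1, by omega⟩, ?_⟩
    rw [hP.label1_west hA rfl]
    have := hA _ hD ⟨i - 1, by omega⟩
    simp only [pointExp_apply] at *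
    split_ifs at * <;> omega
  · obtain ⟨rfl, -⟩ := h
    refine ⟨⟨j - 1, by omega⟩, ?_⟩
    rw [hP.label1_north hA rfl]
    have := hA _ hD ⟨j - 1, by omega⟩
    simp only [pointExp_apply] at *
    split_ifs at * <;> omega

omit hP in
theorem label0_le_label1 {c : P.Cell0} {e : P.Cell1} (h : P.incidence1 c e ≠ 0) :
    P.label0 a c ≤ P.label1 a e := by
  rw [incidence1] at h
  rw [label0, label1]
  split_ifs at h with h1 h2
  · rw [h1]; exact le_sup_right
  · rw [h2]; exact le_sup_left
  · exact absurd rfl h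

/-- Otherwise the label of one end point would divide that of the other, and dually one generator
would divide another. -/
theorem label0_lt_label1 (hn : ∀ i ∈ Finset.Icc 1 P.h, P.lam i ≤ n)
    (hA : ∀ c ∈ P.diagram, pointExp n c ≤ a) {c : P.Cell0} {e : P.Cell1}
    (h : P.incidence1 c e ≠ 0) : ∃ k, P.label0 a c k < P.label1 a e k := by
  by_contra! hle
  obtain ⟨hD, hD', -⟩ := hP.isGoodMove_iff.1 (mem_edges.1 e.2)
  have hne : e.1.1 ≠ e.1.2 := fun he => by
    have := hP.lexLT_of_isGoodMove (mem_edges.1 e.2)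
    rw [he, LexLT] at this
    omega
  have key : ∀ p ∈ P.diagram, ∀ q ∈ P.diagram, a - pointExp n p ≤ a - pointExp n q → q = p := by
    intro p hp q hq hpq
    refine (hP.pointExp_le_iff hn hq hp).1 fun k => ?_
    have h1 := hpq k
    have h2 := hA p hp k
    have h3 := hA q hq k
    simp only [Finsupp.tsub_apply] at h1
    omega
  have hle' : P.label1 a e ≤ P.label0 a c := hle
  rw [label0, label1, sup_le_iff] at hle'
  rw [incidence1] at h
  split_ifs at h with h1 h2
  · rw [h1] at hle'
    exact hne (key _ hD _ hD' hle'.1).symm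
  · rw [h2] at hle'
    exact hne (key _ hD' _ hD hle'.2)
  · exact h rfl

end IsLexOrdered

end RowData

/-! ### Incidence numbers: boundaries of boundaries vanish. -/

namespace RowData

/-- The edges of column `k` between the rows `s` and `r`. -/
noncomputable def chain (P : RowData) (k s r : ℕ) : Finset ((ℕ × ℕ) × (ℕ × ℕ)) :=
  P.edges.filter fun e => (e.1.2 = k ∧ e.2.2 = k) ∧ s ≤ e.2.1 ∧ e.1.1 ≤ r

namespace IsLexOrdered

variable {P : RowData} {n : ℕ} {a : Fin n →₀ ℕ} (hP : P.IsLexOrdered)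
include hP

/-- The good moves of a column join its consecutive points, so the sum telescopes. -/
theorem sum_chain {k s : ℕ} (hs : (s, k) ∈ P.diagram) (ψ : ℕ × ℕ → ℤ) (r : ℕ) (hsr : s ≤ r)
    (hr : (r, k) ∈ P.diagram) : ∑ e ∈ P.chain k s r, (ψ e.2 - ψ e.1) = ψ (s, k) - ψ (r, k) := by
  classical
  induction r using Nat.strong_induction_on with
  | _ r ih =>
  rcases hsr.eq_or_lt with rfl | hlt
  · rw [sub_self]
    refine Finset.sum_eq_zero fun e he => ?_
    rw [chain, Finset.mem_filter, mem_edges] at he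
    obtain ⟨-, -, h | h⟩ := hP.isGoodMove_iff.1 he.1 <;> omega
  · obtain ⟨q, h1, h2, h3⟩ := hP.exists_north hs hr hlt
    have hq := (hP.isGoodMove_iff.1 h3).2.1
    have hins : P.chain k s r = insert ((r, k), (q, k)) (P.chain k s q) := by
      ext ⟨⟨i, j⟩, i', j'⟩
      simp only [chain, Finset.mem_filter, Finset.mem_insert, mem_edges, Prod.mk.injEq]
      constructor
      · rintro ⟨hg, ⟨rfl, rfl⟩, h4, h5⟩
        by_cases hir : i = r
        · subst hir
          have := hP.north_unique hg h3 rfl rfl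
          simp only [Prod.mk.injEq, and_true] at this
          exact Or.inl ⟨⟨rfl, rfl⟩, this, rfl⟩
        · obtain ⟨hD, -, -⟩ := hP.isGoodMove_iff.1 hg
          obtain ⟨-, -, h | ⟨-, -, hno⟩⟩ := hP.isGoodMove_iff.1 h3
          · simp only at h; omega
          refine Or.inr ⟨hg, ⟨rfl, rfl⟩, h4, ?_⟩
          by_contra! hqi
          exact hno i hqi (lt_of_le_of_ne h5 hir) hD
      · rintro (⟨⟨rfl, rfl⟩, rfl, rfl⟩ | ⟨hg, hj, h4, h5⟩)
        · exact ⟨h3, ⟨rfl, rfl⟩, h1, le_rfl⟩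
        · exact ⟨hg, hj, h4, by omega⟩
    rw [hins, Finset.sum_insert, ih q h2 h1 hq]
    · ring
    · simp only [chain, Finset.mem_filter, not_and, not_le]
      intros; omega

omit hP in
theorem incidence1_eq {c : P.Cell0} {e : P.Cell1} (hne : e.1.1 ≠ e.1.2) :
    P.incidence1 c e = (if c.1 = e.1.2 then 1 else 0) - if c.1 = e.1.1 then 1 else 0 := by
  rw [incidence1]
  split_ifs with h1 h2
  · exact absurd (h2.symm.trans h1) hne
  all_goals rfl

theorem isGoodMove_ne {c c' : ℕ × ℕ} (h : P.IsGoodMove c c') : c ≠ c' := by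
  rintro rfl
  have := hP.lexLT_of_isGoodMove h
  rw [LexLT] at this
  omega

theorem sum_incidence1 (e : P.Cell1) : ∑ c : P.Cell0, P.incidence1 c e = 0 := by
  obtain ⟨hD, hD', -⟩ := hP.isGoodMove_iff.1 (mem_edges.1 e.2)
  simp_rw [incidence1_eq (hP.isGoodMove_ne (mem_edges.1 e.2)), Finset.sum_sub_distrib]
  rw [Finset.sum_coe_sort P.diagram (fun c => if c = e.1.2 then (1 : ℤ) else 0),
    Finset.sum_coe_sort P.diagram (fun c => if c = e.1.1 then (1 : ℤ) else 0),
    Finset.sum_ite_eq', Finset.sum_ite_eq', if_pos hD, if_pos hD', sub_self]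

/-- The boundary is top minus bottom plus right minus left. The left side may consist of several
edges, since column `l` can have points in rows that column `l + 1` misses. -/
theorem incidence2_eq {t b l : ℕ} (htb : t < b) (hZ : P.IsTwoCell ⟨t, b, l, l + 1⟩)
    (e : P.Cell1) : P.incidence2 e ⟨_, hZ⟩ =
      (if e.1 = ((t, l + 1), (t, l)) then 1 else 0) -
        (if e.1 = ((b, l + 1), (b, l)) then 1 else 0) +
        (if e.1 ∈ P.chain (l + 1) t b then 1 else 0) - if e.1 ∈ P.chain l t b then 1 else 0 := by
  obtain ⟨⟨⟨i, j⟩, i', j'⟩, he⟩ := e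
  obtain ⟨-, -, h | h⟩ := hP.isGoodMove_iff.1 (mem_edges.1 he)
  · simp only at h
    obtain ⟨rfl, rfl⟩ := h
    simp only [incidence2, chain, Finset.mem_filter, he, Prod.mk.injEq, true_and]
    split_ifs <;> omega
  · simp only at h
    obtain ⟨rfl, h, -⟩ := h
    simp only [incidence2, chain, Finset.mem_filter, he, Prod.mk.injEq, true_and]
    split_ifs <;> omega

theorem twoCell_cases (Z : P.Cell2) : ∃ t b l, ∃ hZ : P.IsTwoCell ⟨t, b, l, l + 1⟩,
    Z = ⟨_, hZ⟩ ∧ t < b ∧ (b, l) ∈ P.diagram ∧ (b, l + 1) ∈ P.diagram ∧ (t, l) ∈ P.diagram ∧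
      (t, l + 1) ∈ P.diagram := by
  obtain ⟨⟨t, b, l, r⟩, hZ⟩ := Z
  obtain ⟨hr, hg, hbl⟩ := hP.isTwoCell_iff.1 hZ
  simp only at hr hg hbl
  subst hr
  obtain ⟨hbr, htr, h | ⟨-, htb, -⟩⟩ := hP.isGoodMove_iff.1 hg
  · simp only at h; omega
  simp only at htb
  exact ⟨t, b, l, hZ, rfl, htb, hbl, hbr, hP.mem_of_corners hbl htr htb.le (by omega), htr⟩

theorem sum_incidence2 (Z : P.Cell2) (c : P.Cell0) :
    ∑ e : P.Cell1, P.incidence2 e Z * P.incidence1 c e = 0 := by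
  classical
  obtain ⟨t, b, l, hZ, rfl, htb, hbl, hbr, htl, htr⟩ := hP.twoCell_cases Z
  -- In terms of the indicator `ψ` of `c`, each side contributes a difference of corner values, and
  -- these cancel around the rectangle.
  set ψ : ℕ × ℕ → ℤ := fun p => if c.1 = p then 1 else 0 with hψ
  have h1 : ∀ e : P.Cell1, P.incidence1 c e = ψ e.1.2 - ψ e.1.1 := fun e =>
    incidence1_eq (hP.isGoodMove_ne (mem_edges.1 e.2))
  simp_rw [h1, hP.incidence2_eq htb hZ, sub_mul, add_mul, sub_mul, Finset.sum_sub_distrib,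
    Finset.sum_add_distrib, Finset.sum_sub_distrib, ite_mul, one_mul, zero_mul]
  rw [Finset.sum_coe_sort P.edges
      (fun e => if e = ((t, l + 1), (t, l)) then ψ e.2 - ψ e.1 else 0),
    Finset.sum_coe_sort P.edges
      (fun e => if e = ((b, l + 1), (b, l)) then ψ e.2 - ψ e.1 else 0),
    Finset.sum_coe_sort P.edges
      (fun e => if e ∈ P.chain (l + 1) t b then ψ e.2 - ψ e.1 else 0),
    Finset.sum_coe_sort P.edges (fun e => if e ∈ P.chain l t b then ψ e.2 - ψ e.1 else 0),
    Finset.sum_ite_eq', Finset.sum_ite_eq', Finset.sum_ite_mem, Finset.sum_ite_mem,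
    Finset.inter_eq_right.2 (show P.chain (l + 1) t b ⊆ P.edges from Finset.filter_subset _ _),
    Finset.inter_eq_right.2 (show P.chain l t b ⊆ P.edges from Finset.filter_subset _ _), hP.sum_chain htl ψ b htb.le hbl,
    hP.sum_chain htr ψ b htb.le hbr, if_pos (mem_edges.2 (hP.west_isGoodMove htr htl)),
    if_pos (mem_edges.2 (hP.west_isGoodMove hbr hbl))]
  ring

/-- Either there is only one edge starting from a given point, or there are a horizontal and a
vertical one, which are two sides of a rectangle. -/
theorem edges_from (E : P.Cell1) : (∀ e : P.Cell1, e.1.1 = E.1.1 → e = E) ∨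
    ∃ (h v : P.Cell1) (b l t : ℕ), h.1 = ((b, l + 1), (b, l)) ∧ v.1 = ((b, l + 1), (t, l + 1)) ∧
      E.1.1 = (b, l + 1) ∧ ∀ e : P.Cell1, e.1.1 = E.1.1 → e = h ∨ e = v := by
  have hex : ∀ e e' : P.Cell1, e.1.1 = e'.1.1 → e.1.2.2 + 1 = e.1.1.2 → e.1.1.1 = e.1.2.1 →
      e'.1.2.2 + 1 = e'.1.1.2 → e'.1.1.1 = e'.1.2.1 → e = e' := by
    rintro ⟨⟨⟨i, j⟩, i', j'⟩, he⟩ ⟨⟨⟨i₁, j₁⟩, i₁', j₁'⟩, he'⟩ h1 h2 h3 h4 h5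
    simp only [Prod.mk.injEq, Subtype.mk.injEq] at *
    omega
  have hey : ∀ e e' : P.Cell1, e.1.1 = e'.1.1 → e.1.1.2 = e.1.2.2 → e'.1.1.2 = e'.1.2.2 →
      e = e' := by
    rintro ⟨⟨c, d⟩, he⟩ ⟨⟨c', d'⟩, he'⟩ h1 h2 h3
    simp only at h1 h2 h3
    subst h1
    obtain rfl : d = d' := hP.north_unique (mem_edges.1 he) (c := c) (mem_edges.1 he') h2 h3
    rfl
  have hmk : ∀ h v : P.Cell1, h.1.1 = v.1.1 → h.1.2.2 + 1 = h.1.1.2 → h.1.1.1 = h.1.2.1 →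
      v.1.1.2 = v.1.2.2 → ∃ b l t, h.1 = ((b, l + 1), (b, l)) ∧
        v.1 = ((b, l + 1), (t, l + 1)) ∧ h.1.1 = (b, l + 1) := by
    rintro ⟨⟨⟨i, j⟩, i', j'⟩, he⟩ ⟨⟨⟨i₁, j₁⟩, i₁', j₁'⟩, he'⟩ h1 h2 h3 h4
    simp only [Prod.mk.injEq] at *
    refine ⟨i, j', i₁', ?_⟩
    omega
  by_cases hall : ∀ e : P.Cell1, e.1.1 = E.1.1 → e = E
  · exact Or.inl hall
  right
  push Not at hall
  obtain ⟨E', hs, hne⟩ := hall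
  have hc : ∀ e : P.Cell1, (e.1.1.1 = e.1.2.1 ∧ e.1.2.2 + 1 = e.1.1.2) ∨ e.1.1.2 = e.1.2.2 := by
    intro e
    obtain ⟨-, -, h | h⟩ := hP.isGoodMove_iff.1 (mem_edges.1 e.2)
    · exact Or.inl h
    · exact Or.inr h.1
  rcases hc E with hE | hE <;> rcases hc E' with hE' | hE'
  · exact absurd (hex _ _ hs hE'.2 hE'.1 hE.2 hE.1) hne
  · obtain ⟨b, l, t, h1, h2, h3⟩ := hmk E E' hs.symm hE.2 hE.1 hE'
    refine ⟨E, E', b, l, t, h1, h2, h3, fun e he => ?_⟩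
    rcases hc e with h | h
    · exact Or.inl (hex _ _ he h.2 h.1 hE.2 hE.1)
    · exact Or.inr (hey _ _ (he.trans hs.symm) h hE')
  · obtain ⟨b, l, t, h1, h2, h3⟩ := hmk E' E hs hE'.2 hE'.1 hE
    refine ⟨E', E, b, l, t, h1, h2, hs ▸ h3, fun e he => ?_⟩
    rcases hc e with h | h
    · exact Or.inl (hex _ _ (he.trans hs.symm) h.2 h.1 hE'.2 hE'.1)
    · exact Or.inr (hey _ _ he h hE)
  · exact absurd (hey _ _ hs hE' hE) hne

end IsLexOrdered

end RowData

/-! ### Exactness and minimality. -/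

namespace RowData

open MvPolynomial

variable {P : RowData} {n : ℕ} {a : Fin n →₀ ℕ} {K : Type*} [Field K]

namespace IsLexOrdered

variable (hP : P.IsLexOrdered)
include hP

theorem d1_comp_d2 (u : P.Cell2 →₀ MvPolynomial (Fin n) K) : P.d1 K a (P.d2 K a u) = 0 :=
  cellularDiff_comp_eq_zero (fun Z e _ => by rw [hP.label2_eq]; exact label1_le e)
    (fun _ _ h => label0_le_label1 h) (fun Z c => hP.sum_incidence2 Z c) u

theorem d0_comp_d1 (u : P.Cell1 →₀ MvPolynomial (Fin n) K) : P.d0 K a (P.d1 K a u) = 0 := by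
  suffices P.d0 K a ∘ₗ P.d1 K a = 0 from DFunLike.congr_fun this u
  ext e : 2
  simp only [LinearMap.comp_apply, Finsupp.lsingle_apply, LinearMap.zero_apply]
  rw [d0, Finsupp.linearCombination_apply, Finsupp.sum_fintype _ _ (by simp)]
  calc _ = ∑ c, monomial (P.label1 a e) ((P.incidence1 c e : ℤ) : K) := by
        refine Finset.sum_congr rfl fun c _ => ?_
        rw [d1, cellularDiff_single, one_mul, smul_eq_mul, monomial_mul, mul_one]
        by_cases h : P.incidence1 c e = 0
        · simp [h]
        · rw [tsub_add_cancel_of_le (label0_le_label1 h)]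
    _ = 0 := by rw [← map_sum, ← Int.cast_sum, hP.sum_incidence1, Int.cast_zero, map_zero]

theorem incidence1_start (e : P.Cell1) {c : P.Cell0} (h : e.1.1 = c.1) :
    P.incidence1 c e = -1 := by
  rw [incidence1_eq (hP.isGoodMove_ne (mem_edges.1 e.2)), if_pos h.symm, if_neg, zero_sub]
  rw [← h]
  exact hP.isGoodMove_ne (mem_edges.1 e.2)

omit hP in
/-- The bottom side of a rectangle. -/
theorem incidence2_bottom {t b l : ℕ} (hZ : P.IsTwoCell ⟨t, b, l, l + 1⟩) {e : P.Cell1}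
    (he : e.1 = ((b, l + 1), (b, l))) : P.incidence2 e ⟨_, hZ⟩ = -1 := by
  have htb := hZ.1
  simp only at htb
  simp only [incidence2, he, true_and]
  split_ifs <;> omega

omit hP in
/-- The right side of a rectangle. -/
theorem incidence2_right {t b l : ℕ} (hZ : P.IsTwoCell ⟨t, b, l, l + 1⟩) {e : P.Cell1}
    (he : e.1 = ((b, l + 1), (t, l + 1))) : P.incidence2 e ⟨_, hZ⟩ = 1 := by
  have htb := hZ.1
  simp only at htb
  simp only [incidence2, he, true_and]
  split_ifs <;> omega

/-- Choose a rectangle of the support with southernmost bottom. Another rectangle containing its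
bottom side has it as top side, and so reaches further south, or as bottom side, and then coincides
with it. So its coefficient vanishes. -/
theorem d2_injective : Function.Injective (P.d2 K a) := by
  rw [injective_iff_map_eq_zero]
  intro u hu
  by_contra hne
  obtain ⟨Z, hZu, hmax⟩ := u.support.exists_max_image (fun Z => Z.1.bot)
    (Finsupp.support_nonempty_iff.2 hne)
  obtain ⟨t, b, l, hZ, rfl, htb, hbl, hbr, htl, htr⟩ := hP.twoCell_cases Z
  let h : P.Cell1 := ⟨((b, l + 1), (b, l)), mem_edges.2 (hP.west_isGoodMove hbr hbl)⟩
  have hcoef := DFunLike.congr_fun hu h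
  rw [d2, cellularDiff_apply_of_unique ⟨_, hZ⟩, Finsupp.zero_apply] at hcoef
  · rw [incidence2_bottom hZ rfl, mul_eq_zero, monomial_eq_zero] at hcoef
    rcases hcoef with h0 | h0
    · exact Finsupp.mem_support_iff.1 hZu h0
    · simp at h0
  · intro Z' hne' hZu'
    by_contra hinc
    apply hne'
    obtain ⟨t', b', l', hZ', rfl, htb', hbl', hbr', htl', htr'⟩ := hP.twoCell_cases Z'
    have hb := hmax _ (Finsupp.mem_support_iff.2 hZu')
    simp only at hb
    have hll : l' = l ∧ b' = b := by
      simp only [incidence2, h] at hinc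
      split_ifs at hinc <;> omega
    obtain ⟨rfl, rfl⟩ := hll
    have h1 := (hP.isTwoCell_iff.1 hZ).2.1
    have h2 := (hP.isTwoCell_iff.1 hZ').2.1
    have h3 := hP.north_unique h1 h2 rfl rfl
    simp only [Prod.mk.injEq, and_true] at h3
    subst h3
    rfl

/-- Edges are ranked by their starting points. An edge that ends at the leading starting point
starts later, so the coefficient there involves outgoing edges only. If there are two, their
rectangle cancels both, and its other edges start at earlier points. -/
theorem ker_d1_le (hn : ∀ i ∈ Finset.Icc 1 P.h, P.lam i ≤ n)
    (hA : ∀ c ∈ P.diagram, pointExp n c ≤ a) :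
    LinearMap.ker (P.d1 K a) ≤ LinearMap.range (P.d2 K a) := by
  refine Finsupp.le_of_elimination (fun e : P.Cell1 => rank n e.1.1) ?_ ?_
  · rintro _ ⟨u, rfl⟩
    exact hP.d1_comp_d2 u
  intro m u hu hm
  by_cases hlead : ∀ e : P.Cell1, u e ≠ 0 → rank n e.1.1 ≠ m
  · refine ⟨0, Submodule.zero_mem _, fun e he => ?_⟩
    rw [sub_zero] at he
    exact lt_of_le_of_ne (hm e he) (hlead e he)
  push Not at hlead
  obtain ⟨E, hE, hrank⟩ := hlead
  have hstart : ∀ e : P.Cell1, e.1.1 ∈ P.diagram := fun e =>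
    (hP.isGoodMove_iff.1 (mem_edges.1 e.2)).1
  have hcol : ∀ e : P.Cell1, e.1.1.2 ≤ n := fun e => col_le hn (hstart e)
  have hcoef := DFunLike.congr_fun (LinearMap.mem_ker.1 hu) (⟨E.1.1, hstart E⟩ : P.Cell0)
  rw [Finsupp.zero_apply] at hcoef
  have hzero : ∀ e : P.Cell1, e.1.1 ≠ E.1.1 → u e ≠ 0 →
      P.incidence1 ⟨E.1.1, hstart E⟩ e = 0 := by
    intro e hne hue
    rw [incidence1, if_neg, if_neg hne.symm]
    intro heq
    simp only at heq
    have h1 := rank_lt_of_lexLT (n := n) (heq ▸ hcol E)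
      (hP.lexLT_of_isGoodMove (mem_edges.1 e.2))
    have h2 := hm e hue
    rw [← heq] at h1
    omega
  rcases hP.edges_from E with hall | ⟨h, v, b, l, t, hh, hv, hEs, hall⟩
  · exfalso
    rw [d1, cellularDiff_apply_of_unique E fun e hne hue =>
      hzero e (fun heq => hne (hall e heq)) hue, hP.incidence1_start E rfl, mul_eq_zero,
      monomial_eq_zero] at hcoef
    rcases hcoef with h0 | h0
    · exact hE h0
    · simp at h0
  have hhv : h ≠ v := by
    rintro rfl
    rw [hh] at hv
    simp at hv
  have hvg := mem_edges.1 v.2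
  have hhg := mem_edges.1 h.2
  rw [hv] at hvg
  rw [hh] at hhg
  obtain ⟨hbr, hbl, -⟩ := hP.isGoodMove_iff.1 hhg
  simp only at hbr hbl
  have hle := hP.le_of_mem hbl
  have hln := col_le hn hbr
  simp only at hln
  have hZ : P.IsTwoCell ⟨t, b, l, l + 1⟩ := hP.isTwoCell_iff.2 ⟨rfl, hvg, hbl⟩
  let x : Fin n := ⟨b - 1, by omega⟩
  let y : Fin n := ⟨l, by omega⟩
  have hAbr := hA _ hbr
  have e1 : P.label1 a h - P.label0 a ⟨E.1.1, hstart E⟩ = Finsupp.single y 1 := by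
    ext k
    have := hAbr k
    rw [Finsupp.tsub_apply, hP.label1_west hA hh, label0, Finsupp.tsub_apply,
      Finsupp.single_apply]
    simp only [hEs, pointExp_apply, y, Fin.ext_iff] at *
    split_ifs at * <;> omega
  have e2 : P.label1 a v - P.label0 a ⟨E.1.1, hstart E⟩ = Finsupp.single x 1 := by
    ext k
    have := hAbr k
    rw [Finsupp.tsub_apply, hP.label1_north hA hv, label0, Finsupp.tsub_apply,
      Finsupp.single_apply]
    simp only [hEs, pointExp_apply, x, Fin.ext_iff] at *
    split_ifs at * <;> omega
  have e3 : P.label2 a ⟨_, hZ⟩ - P.label1 a h = Finsupp.single x 1 := by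
    ext k
    have := hAbr k
    rw [hP.label2_eq, Finsupp.tsub_apply, hP.label1_west hA hh, Finsupp.single_apply]
    simp only [pointExp_apply, x, Fin.ext_iff] at *
    split_ifs at * <;> omega
  have e4 : P.label2 a ⟨_, hZ⟩ - P.label1 a v = Finsupp.single y 1 := by
    ext k
    have := hAbr k
    rw [hP.label2_eq, Finsupp.tsub_apply, hP.label1_north hA hv, Finsupp.single_apply]
    simp only [pointExp_apply, y, Fin.ext_iff] at *
    split_ifs at * <;> omega
  have hneg : ∀ z : Fin n, monomial (Finsupp.single z 1) (((-1 : ℤ)) : K) = -X z := by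
    intro z
    rw [Int.cast_neg, Int.cast_one, map_neg]
    rfl
  have hpos : ∀ z : Fin n, monomial (Finsupp.single z 1) (((1 : ℤ)) : K) = X z := by
    intro z
    rw [Int.cast_one]
    rfl
  rw [d1, cellularDiff_apply_of_pair hhv fun e h1 h2 hue => hzero e
      (fun heq => (hall e heq).elim h1 h2) hue, hP.incidence1_start h (by rw [hh]; exact hEs.symm),
    hP.incidence1_start v (by rw [hv]; exact hEs.symm), e1, e2, hneg, hneg] at hcoef
  -- Here `x` and `y` stand for `x_b` and `x_{l+1}`, which differ because `(b, l)` is a point and so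
  -- `b ≤ l`.
  have hdvd : X x ∣ u h := by
    have : X x ∣ u h * X y := ⟨-u v, by linear_combination -hcoef⟩
    rcases X_prime.dvd_or_dvd this with h1 | h1
    · exact h1
    · rw [X_dvd_X, Fin.mk.injEq] at h1
      omega
  obtain ⟨w, hw⟩ := hdvd
  have hw' : u v = -(w * X y) := by
    apply mul_right_cancel₀ (X_ne_zero x)
    rw [hw] at hcoef
    linear_combination -hcoef
  refine ⟨P.d2 K a (Finsupp.single ⟨_, hZ⟩ (-w)), ⟨_, rfl⟩, fun e he => ?_⟩
  rw [Finsupp.sub_apply, d2, cellularDiff_single] at he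
  have hneh : e ≠ h := by
    rintro rfl
    rw [e3, incidence2_bottom hZ hh, hneg, hw] at he
    exact he (by ring)
  have hnev : e ≠ v := by
    rintro rfl
    rw [e4, incidence2_right hZ hv, hpos, hw'] at he
    exact he (by ring)
  have hEe : e.1.1 ≠ E.1.1 := fun heq => (hall e heq).elim hneh hnev
  by_cases hinc : P.incidence2 e ⟨_, hZ⟩ = 0
  · rw [hinc, Int.cast_zero, map_zero, mul_zero, sub_zero] at he
    exact lt_of_le_of_ne (hm e he) fun heq =>
      hEe (rank_inj (hcol e) (hcol E) (heq.trans hrank.symm))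
  · rw [← hrank]
    refine rank_lt_of_lexLT (hcol e) ?_
    rw [hEs] at hEe ⊢
    have htb := hZ.1
    obtain ⟨⟨⟨i, j⟩, i', j'⟩, he'⟩ := e
    obtain ⟨-, -, hg⟩ := hP.isGoodMove_iff.1 (mem_edges.1 he')
    simp only [incidence2, LexLT, Ne, Prod.mk.injEq] at hinc hEe hg htb ⊢
    split_ifs at hinc <;> omega

/-- If `c` is the leading point of a cycle `u`, then `u c` lies in the colon ideal of the earlier
labels by the label of `c`. By linear quotients, each of its terms is the coefficient at `c` of the
boundary of a multiple of a good move from `c`. -/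
theorem ker_d0_le (hn : ∀ i ∈ Finset.Icc 1 P.h, P.lam i ≤ n)
    (hX : ∀ c ∈ P.diagram, {c' | P.IsGoodMove c c'}.ncard = 2 ↔ (P.exchangeSet n c).ncard = 2)
    (hA : ∀ c ∈ P.diagram, pointExp n c ≤ a) :
    LinearMap.ker (P.d0 K a) ≤ LinearMap.range (P.d1 K a) := by
  classical
  refine Finsupp.le_of_elimination (fun c : P.Cell0 => rank n c.1) ?_ ?_
  · rintro _ ⟨u, rfl⟩
    exact hP.d0_comp_d1 u
  intro m u hu hm
  by_cases hlead : ∀ c : P.Cell0, u c ≠ 0 → rank n c.1 ≠ m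
  · refine ⟨0, Submodule.zero_mem _, fun e he => ?_⟩
    rw [sub_zero] at he
    exact lt_of_le_of_ne (hm e he) (hlead e he)
  push Not at hlead
  obtain ⟨c, hc, hrank⟩ := hlead
  have hcol : ∀ c : P.Cell0, c.1.2 ≤ n := fun c => col_le hn c.2
  have hsmall : ∀ c' : P.Cell0, u c' ≠ 0 → c' ≠ c → LexLT c'.1 c.1 := by
    intro c' hc' hne
    refine lexLT_of_rank_lt (hcol c) (lt_of_le_of_ne (hrank ▸ hm c' hc') fun heq => ?_)
    exact hne (Subtype.ext (rank_inj (hcol c') (hcol c) heq))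
  have hcolon : u c * monomial (P.label0 a c) (1 : K) ∈ Ideal.span
      ((fun s => monomial s (1 : K)) '' (P.label0 a '' {c' | LexLT c'.1 c.1})) := by
    have h1 : P.d0 K a (Finsupp.single c (u c) + u.erase c) = 0 := by
      rw [Finsupp.single_add_erase]; exact hu
    rw [map_add, d0, Finsupp.linearCombination_single, smul_eq_mul] at h1
    rw [eq_neg_of_add_eq_zero_left h1]
    refine neg_mem ?_
    rw [Finsupp.linearCombination_apply]
    refine Submodule.sum_mem _ fun c' hc' => Ideal.mul_mem_left _ _ (Ideal.subset_span ?_)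
    rw [Finsupp.support_erase, Finset.mem_erase, Finsupp.mem_support_iff] at hc'
    exact ⟨_, ⟨c', hsmall c' hc'.2 hc'.1, rfl⟩, rfl⟩
  -- The coefficients at `c` of boundaries supported on `c` and earlier points form a submodule, so
  -- `u c` can be treated term by term.
  have hlift : u c ∈ Submodule.map (Finsupp.lapply c) (LinearMap.range (P.d1 K a) ⊓
      Finsupp.supported (MvPolynomial (Fin n) K) (MvPolynomial (Fin n) K)
        {c' : P.Cell0 | c' = c ∨ rank n c'.1 < m}) := by
    rw [← support_sum_monomial_coeff (u c)]
    refine Submodule.sum_mem _ fun s hs => ?_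
    obtain ⟨_, ⟨c', hlt, rfl⟩, hle⟩ := mem_ideal_span_monomial_image.1 hcolon
      (s + P.label0 a c) (by
        rw [mem_support_iff, coeff_mul_monomial, mul_one]
        exact mem_support_iff.1 hs)
    obtain ⟨d, hg, hinf⟩ := hP.exists_isGoodMove_inf_le hn hX c.2 c'.2 hlt
    have hd := (hP.isGoodMove_iff.1 hg).2.1
    let E : P.Cell1 := ⟨(c.1, d), mem_edges.2 hg⟩
    -- As `gcd(f_c, f_{c'})` divides `f_d`, the label of `d` divides the lcm of those of `c` and
    -- `c'`, which divides the given monomial.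
    have hE : P.label1 a E ≤ s + P.label0 a c := by
      refine sup_le le_add_self fun k => ?_
      change (a - pointExp n d) k ≤ (s + P.label0 a c) k
      have h1 := hle k
      have h2 := hinf k
      have h3 := hA _ c.2 k
      have h4 := hA _ c'.2 k
      simp only [label0, Finsupp.add_apply, Finsupp.tsub_apply, Finsupp.inf_apply,
        inf_le_iff] at h1 h2 ⊢
      omega
    have hsub : s + P.label0 a c - P.label1 a E + (P.label1 a E - P.label0 a c) = s := by
      rw [tsub_add_tsub_cancel hE (show P.label0 a c ≤ P.label1 a E from le_sup_left), add_tsub_cancel_right]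
    refine ⟨P.d1 K a (Finsupp.single E (monomial (s + P.label0 a c - P.label1 a E)
      (-coeff s (u c)))), ⟨⟨_, rfl⟩, ?_⟩, ?_⟩
    · rw [SetLike.mem_coe, Finsupp.mem_supported']
      intro c'' hc''
      rw [d1, cellularDiff_single, incidence1, if_neg, if_neg, Int.cast_zero, map_zero, mul_zero]
      · exact fun h => hc'' (Or.inl (Subtype.ext h))
      · intro h
        refine hc'' (Or.inr ?_)
        rw [← hrank, h]
        exact rank_lt_of_lexLT (col_le hn hd) (hP.lexLT_of_isGoodMove hg)
    · rw [Finsupp.lapply_apply, d1, cellularDiff_single, hP.incidence1_start E rfl,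
        monomial_mul, hsub]
      simp
  obtain ⟨v, ⟨hv, hvs⟩, hvc⟩ := hlift
  rw [SetLike.mem_coe, Finsupp.mem_supported'] at hvs
  rw [Finsupp.lapply_apply] at hvc
  refine ⟨v, hv, fun c' hc' => ?_⟩
  rw [Finsupp.sub_apply] at hc'
  by_contra hlt
  have hne : c' ≠ c := by
    rintro rfl
    exact hc' (by rw [hvc, sub_self])
  rw [hvs c' (fun h => h.elim hne hlt), sub_zero] at hc'
  exact hlt (hrank ▸ rank_lt_of_lexLT (hcol c') (hsmall c' hc' hne))

omit hP in
theorem range_d0 : LinearMap.range (P.d0 K a) =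
    Ideal.span (Set.range fun c : P.Cell0 => monomial (P.label0 a c) (1 : K)) := by
  rw [d0, Finsupp.range_linearCombination]

theorem supportsResolution (hn : ∀ i ∈ Finset.Icc 1 P.h, P.lam i ≤ n)
    (hX : ∀ c ∈ P.diagram, {c' | P.IsGoodMove c c'}.ncard = 2 ↔ (P.exchangeSet n c).ncard = 2)
    (hA : ∀ c ∈ P.diagram, pointExp n c ≤ a) :
    P.SupportsResolution a (dualIdeal a (P.ideal K n)) where
  resolution :=
    { injective := hP.d2_injective
      exact₁ := fun u => ⟨fun hu => hP.ker_d1_le hn hA hu, by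
        rintro ⟨v, rfl⟩
        exact hP.d1_comp_d2 v⟩
      exact₀ := fun u => ⟨fun hu => hP.ker_d0_le hn hX hA hu, by
        rintro ⟨v, rfl⟩
        exact hP.d0_comp_d1 v⟩
      exact_aug := by
        rw [LinearMap.exact_iff, Submodule.ker_mkQ, hP.dualIdeal_eq hn, range_d0] }
  homogeneous₂ := cellularDiff_isMultihomogeneous fun Z e _ => by
    rw [hP.label2_eq]; exact label1_le e
  homogeneous₁ := cellularDiff_isMultihomogeneous fun _ _ h => label0_le_label1 h
  homogeneous₀ := fun c => ⟨1, by rw [d0, Finsupp.linearCombination_single, one_smul]⟩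

theorem supportsMinimalResolution (hn : ∀ i ∈ Finset.Icc 1 P.h, P.lam i ≤ n)
    (hX : ∀ c ∈ P.diagram, {c' | P.IsGoodMove c c'}.ncard = 2 ↔ (P.exchangeSet n c).ncard = 2)
    (hA : ∀ c ∈ P.diagram, pointExp n c ≤ a) (hne : dualIdeal a (P.ideal K n) ≠ ⊤) :
    P.SupportsMinimalResolution a (dualIdeal a (P.ideal K n)) where
  toSupportsResolution := hP.supportsResolution hn hX hA
  minimal₂ := cellularDiff_isMinimalMap fun Z e _ => by
    rw [hP.label2_eq]; exact hP.label1_lt hn hA e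
  minimal₁ := cellularDiff_isMinimalMap fun _ _ h => hP.label0_lt_label1 hn hA h
  minimal₀ := by
    rw [IsMinimalMap, range_d0, Submodule.span_le]
    rintro _ ⟨c, rfl⟩
    rw [smul_eq_mul, Ideal.mul_top]
    -- A vertex label `1` would make the dual the unit ideal.
    obtain ⟨k, hk⟩ : ∃ k, P.label0 a c k ≠ 0 := by
      by_contra! h0
      refine hne ((Ideal.eq_top_iff_one _).2 ?_)
      rw [hP.dualIdeal_eq hn]
      refine Ideal.subset_span ⟨c, ?_⟩
      simp only [show P.label0 a c = 0 from Finsupp.ext h0]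
      rfl
    exact mem_of_X_dvd (X_dvd_monomial.2 (Or.inr hk))

end IsLexOrdered

end RowData

theorem theorem6 {K : Type*} [Field K] {n : ℕ} (a : Fin n →₀ ℕ) (P : RowData)
    (hP : P.IsShiftedPartition) (hn : ∀ i ∈ Finset.Icc 1 P.h, P.lam i ≤ n)
    (hcomp : P.IsCompatible n) (ha : IsDetermined a (P.ideal K n)) :
    P.SupportsResolution a (dualIdeal a (P.ideal K n)) ∧
      (dualIdeal a (P.ideal K n) ≠ ⊤ →
        P.SupportsMinimalResolution a (dualIdeal a (P.ideal K n))) := by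
  obtain ⟨hconn, hwest, hX⟩ := hcomp
  have hL := RowData.isLexOrdered hP hconn hwest
  have hA : ∀ c ∈ P.diagram, pointExp n c ≤ a := fun c hc => hL.pointExp_le hn ha hc
  exact ⟨hL.supportsResolution hn hX hA, hL.supportsMinimalResolution hn hX hA⟩
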